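/- **Setting.** Let $d\ge 1$ and let $\mathcal K\subset\mathbb R^d$ be convex and compact with non-empty interior. For $M,\nu\ge 0$, a function $\Phi:\operatorname{int}\mathcal K\to\mathbb R$ is an $(M,\nu)$-self-concordant barrier for $\mathcal K$ if it is convex and $C^3$, tends to $+\infty$ at every boundary point of $\mathcal K$, and satisfies $|\nabla^3\Phi(x)[u,u,u]|\le 2M\|u\|_{\nabla^2\Phi(x)}^3$ and $\nabla\Phi(x)^\top\nabla^{-2}\Phi(x)\nabla\Phi(x)\le\nu$ for all $x\in\operatorname{int}\mathcal K$, $u\in\mathbb R^d$. Here $\|u\|_A=\sqrt{u^\top Au}$ and $\nabla^{-2}=(\nabla^2)^{-1}$. Let $w^\star\in\operatorname{argmin}\Phi$ and, for $c\in(0,1)$, let $\mathcal K_c=(1-c)\mathcal K+\{c\,w^\star\}$. A gradient oracle of tolerance $\varepsilon$ returns, for $w\in\operatorname{int}\mathcal K$, a vector $\hat\nabla_w$ with $\|\hat\nabla_w-\nabla\Phi(w)\|_{\nabla^{-2}\Phi(w)}\le\varepsilon$, at a cost of at most $\mathcal C^{\mathrm{grad}}_\varepsilon$ elementary operations per call.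 A Hessian oracle of tolerance $\alpha$ returns $H$ and $H^{-1}$ with $(1-\alpha)\nabla^2\Phi(w)\preccurlyeq H\preccurlyeq(1+\alpha)\nabla^2\Phi(w)$ and $(1-\alpha)\nabla^{-2}\Phi(w)\preccurlyeq H^{-1}\preccurlyeq(1+\alpha)\nabla^{-2}\Phi(w)$, at a cost of at most $\mathcal C^{\mathrm{hess}}_\alpha$ per call. **Algorithm (BARONS), with parameters $\eta,\varepsilon,\alpha,M,m_{\mathrm{Newton}}$.** Start with $u_1=w_1=w^\star$, let $H_1$ be the answer of the Hessian oracle at $w^\star$, and let $s_0=0$. In round $t=1,\dots,T$: play $w_t$ and observe a subgradient $g_t$ of the loss $\ell_t$ at $w_t$; set $s_t=s_{t-1}+\eta g_t$; starting from $w=w_t$, perform $m_{\mathrm{Newton}}-1$ times the step $w\leftarrow w-H_t^{-1}(\hat\nabla_w+s_t)$ with the gradient oracle's answer $\hat\nabla_w$ at $w$; let $w_{t+1}$ be the result. If $\|w_{t+1}-u_t\|_{H_t}\le\frac1{41M}$, keep $u_{t+1}=u_t$, $H_{t+1}=H_t$; otherwise set $u_{t+1}=w_{t+1}$ and let $H_{t+1},H_{t+1}^{-1}$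 be the Hessian oracle's answer at $u_{t+1}$. **Theorem.** There are universal constants $a,C>0$ and, for every $A$, a constant $C'>0$ depending only on $A$, such that the following holds. Let $\Phi$ be an $(M_\Phi,\nu)$-self-concordant barrier for $\mathcal K$ with $M_\Phi>0$, let $c\in(0,1)$, $b>0$, $T\ge1$, and run BARONS with $M=M_\Phi$, $$\eta=\sqrt{\frac{\nu\log(1/c)}{b^2T}},\qquad \varepsilon=\sqrt{\frac{\nu}{T}},\qquad \alpha=0.001,\qquad a\log\frac1{\varepsilon M_\Phi}\le m_{\mathrm{Newton}}\le A\log\frac1{\varepsilon M_\Phi}.$$ Suppose that $T$ is so large that $\eta\le\frac1{1000\,b\,M_\Phi}$ and $\varepsilon\le\frac1{20000\,M_\Phi}$, and that $\|g_t\|_{\nabla^{-2}\Phi(w_t)}\le b$ for all $t\in\{1,\dots,T\}$, where $\ell_t(y)\ge\ell_t(w_t)+\langle g_t,y-w_t\rangle$ for all $y\in\operatorname{int}\mathcal K$. Then all $w_1,\dots,w_T$ lie in $\operatorname{int}\mathcal K$, $$\sum_{t=1}^T\ell_t(w_t)-\sum_{t=1}^T\ell_t(w)\le C\,b\sqrt{\nu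 T\,(1+\log(1/c))}\qquad\text{for all }w\in\mathcal K_c,$$ and the total number of elementary operations (oracle calls included) in the $T$ rounds is at most $$C'\left(\left(\mathcal C^{\mathrm{grad}}_\varepsilon+d^2\right)T\log\frac{T}{\nu M_\Phi^2}+\mathcal C^{\mathrm{hess}}_\alpha\,M_\Phi\sqrt{T\nu\,(1+\log(1/c))}\right).$$ -/

import Mathlib

open scoped Pointwise

namespace Barons

noncomputable section

/-! ### Vectors, matrices, local norms -/

/-- The Euclidean space `ℝᵈ`. -/
abbrev Vec (d : ℕ) : Type := EuclideanSpace ℝ (Fin d)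

/-- Real `d × d` matrices. -/
abbrev Mat (d : ℕ) : Type := Matrix (Fin d) (Fin d) ℝ

/-- The quadratic form `xᵀ A x`. -/
def quadForm {d : ℕ} (A : Mat d) (x : Vec d) : ℝ := x.ofLp ⬝ᵥ A.mulVec x.ofLp

/-- The norm `‖x‖_A = √(xᵀ A x)`. -/
def localNorm {d : ℕ} (A : Mat d) (x : Vec d) : ℝ := Real.sqrt (quadForm A x)

/-- The Loewner order `A ≼ B` on symmetric matrices: `B - A` is symmetric positive semidefinite. -/
def Loewner {d : ℕ} (A B : Mat d) : Prop := (B - A).PosSemidef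

/-- The Hessian matrix `∇²f(w)` in the standard basis. -/
def hessian {d : ℕ} (f : Vec d → ℝ) (w : Vec d) : Mat d :=
  Matrix.of fun i j =>
    iteratedFDeriv ℝ 2 f w ![EuclideanSpace.single i 1, EuclideanSpace.single j 1]

/-! ### Self-concordant functions and barriers

A function on `int K` is represented by a function on all of `ℝᵈ`; only its values on the open set
`int K` matter below. -/

/-- `f : int K → ℝ` is self-concordant with constant `M ≥ 0`. -/
structure IsSelfConcordant {d : ℕ} (K : Set (Vec d)) (f : Vec d → ℝ) (M : ℝ) : Prop where
  nonneg : 0 ≤ M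
  convex : ConvexOn ℝ (interior K) f
  smooth : ContDiffOn ℝ 3 f (interior K)
  blowup : ∀ x ∈ frontier K, Filter.Tendsto f (nhdsWithin x (interior K)) Filter.atTop
  third_le : ∀ x ∈ interior K, ∀ u : Vec d,
    |iteratedFDeriv ℝ 3 f x (fun _ => u)| ≤ 2 * M * localNorm (hessian f x) u ^ 3

/-- `f : int K → ℝ` is an `(M, ν)`-self-concordant barrier for `K`:
it is self-concordant with constant `M`, and `∇f(w)ᵀ ∇⁻²f(w) ∇f(w) ≤ ν` on `int K`.
(For compact `K` with non-empty interior the Hessian of a self-concordant function is automatically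
positive definite on `int K`, so that the matrix inverse is a genuine one.) -/
structure IsBarrier {d : ℕ} (K : Set (Vec d)) (f : Vec d → ℝ) (M ν : ℝ) : Prop where
  selfConcordant : IsSelfConcordant K f M
  nonneg : 0 ≤ ν
  grad_le : ∀ w ∈ interior K, quadForm (hessian f w)⁻¹ (gradient f w) ≤ ν

/-- `w⋆ ∈ argmin Φ`; as `Φ = +∞` on the boundary of `K`, the minimizer lies in `int K`. -/
def IsBarrierMin {d : ℕ} (K : Set (Vec d)) (Φ : Vec d → ℝ) (w : Vec d) : Prop :=
  w ∈ interior K ∧ IsMinOn Φ (interior K) w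

/-- The shrunken set `K_c = (1 - c) K ⊕ {c w⋆}`. -/
def shrunken {d : ℕ} (K : Set (Vec d)) (wstar : Vec d) (c : ℝ) : Set (Vec d) :=
  (1 - c) • K + {c • wstar}

/-- `g` is a subgradient of `l` at `x`, with respect to the points of `S`. -/
def IsSubgradient {d : ℕ} (S : Set (Vec d)) (l : Vec d → ℝ) (x g : Vec d) : Prop :=
  ∀ y ∈ S, l x + inner ℝ g (y - x) ≤ l y

/-! ### Computations with a count of elementary operations -/

/-- A result together with the number of elementary operations spent on computing it. -/
structure Timed (α : Type) where
  val : α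
  cost : ℕ

namespace Timed

/-- Sequential composition adds costs; reusing a computed value is free. -/
instance : Monad Timed where
  pure a := ⟨a, 0⟩
  bind x f := ⟨(f x.val).val, x.cost + (f x.val).cost⟩

/-- One elementary operation (real arithmetic, square root, comparison, input or output of a real
number) with result `a`. -/
def op {α : Type} (a : α) : Timed α := ⟨a, 1⟩

/-- Compute a vector coordinate by coordinate. -/
def vec {d : ℕ} (f : Fin d → Timed ℝ) : Timed (Vec d) :=
  ⟨WithLp.toLp 2 fun i => (f i).val, ∑ i, (f i).cost⟩

/-- Compute `d` real numbers and add them up, with one operation per addition. -/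
def sum {d : ℕ} (f : Fin d → Timed ℝ) : Timed ℝ :=
  ⟨∑ i, (f i).val, ∑ i, ((f i).cost + 1)⟩

/-- Transmit a vector (play an iterate, read a subgradient). -/
def copy {d : ℕ} (x : Vec d) : Timed (Vec d) := vec fun i => op (x i)

def add {d : ℕ} (x y : Vec d) : Timed (Vec d) := vec fun i => op (x i + y i)

def sub {d : ℕ} (x y : Vec d) : Timed (Vec d) := vec fun i => op (x i - y i)

def smul {d : ℕ} (r : ℝ) (x : Vec d) : Timed (Vec d) := vec fun i => op (r * x i)

def dot {d : ℕ} (x y : Vec d) : Timed ℝ := sum fun i => op (x i * y i)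

def matVec {d : ℕ} (A : Mat d) (x : Vec d) : Timed (Vec d) :=
  vec fun i => sum fun j => op (A i j * x j)

/-- Computation of `‖x‖_A`. -/
def norm {d : ℕ} (A : Mat d) (x : Vec d) : Timed ℝ := do
  let y ← matVec A x
  let q ← dot x y
  op (Real.sqrt q)

open Classical in
/-- Comparison of two real numbers. -/
def le (x y : ℝ) : Timed Bool := op (decide (x ≤ y))

end Timed

/-! ### Oracles -/

/-- `O` is a gradient oracle for `Φ` on `int K` with tolerance `ε`,
each call of which costs at most `C` operations. -/
def IsGradOracle {d : ℕ} (K : Set (Vec d)) (Φ : Vec d → ℝ) (ε : ℝ) (C : ℕ)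
    (O : Vec d → Timed (Vec d)) : Prop :=
  ∀ w ∈ interior K,
    localNorm (hessian Φ w)⁻¹ ((O w).val - gradient Φ w) ≤ ε ∧ (O w).cost ≤ C

/-- `O` is a Hessian oracle for `Φ` on `int K` with tolerance `α`, each call of which costs at most
`C` operations: it returns a matrix `H` and its inverse, both of them `1 ± α` spectral
approximations of the Hessian and of the inverse Hessian. -/
def IsHessOracle {d : ℕ} (K : Set (Vec d)) (Φ : Vec d → ℝ) (α : ℝ) (C : ℕ)
    (O : Vec d → Timed (Mat d × Mat d)) : Prop :=
  ∀ w ∈ interior K,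
    (O w).val.1 * (O w).val.2 = 1 ∧
    Loewner ((1 - α) • hessian Φ w) (O w).val.1 ∧
    Loewner (O w).val.1 ((1 + α) • hessian Φ w) ∧
    Loewner ((1 - α) • (hessian Φ w)⁻¹) (O w).val.2 ∧
    Loewner (O w).val.2 ((1 + α) • (hessian Φ w)⁻¹) ∧
    (O w).cost ≤ C

/-! ### The algorithm -/

/-- The input of the algorithm: the step size `η`, the self-concordance constant `M`, the parameter
`mNewton`, the two oracles (which carry the tolerances `ε` and `α`) and the minimizer `w⋆`. -/
structure Input (d : ℕ) where
  η : ℝ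
  M : ℝ
  mNewton : ℕ
  gradOracle : Vec d → Timed (Vec d)
  hessOracle : Vec d → Timed (Mat d × Mat d)
  wstar : Vec d

/-- The memory of the algorithm at the beginning of a round: the iterate `w`, the landmark `u`, the
matrix `H` at the landmark with its inverse, and the sum `s` of the `η g` seen so far. -/
structure State (d : ℕ) where
  w : Vec d
  u : Vec d
  H : Mat d
  Hinv : Mat d
  s : Vec d

/-- Initialization: `u = w = w⋆`, `H = O_hess(w⋆)`, `s = 0`. -/
def init {d : ℕ} (P : Input d) : Timed (State d) := do
  let R ← P.hessOracle P.wstar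
  let z ← Timed.vec fun _ => Timed.op 0
  return { w := P.wstar, u := P.wstar, H := R.1, Hinv := R.2, s := z }

/-- `k` intermediate Newton steps `w ↦ w - H⁻¹ (O_grad(w) + s)`. -/
def newtonSteps {d : ℕ} (P : Input d) (Hinv : Mat d) (s : Vec d) : ℕ → Vec d → Timed (Vec d)
  | 0, w => return w
  | k + 1, w => do
    Timed.op ()
    let ghat ← P.gradOracle w
    let gtilde ← Timed.add ghat s
    let p ← Timed.matVec Hinv gtilde
    let w' ← Timed.sub w p
    newtonSteps P Hinv s k w'

/-- One round, in which the iterate `S.w` is played and the subgradient `g` is observed. -/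
def round {d : ℕ} (P : Input d) (g : Vec d) (S : State d) : Timed (State d) := do
  let _ ← Timed.copy S.w
  let g ← Timed.copy g
  let v ← Timed.smul P.η g
  let s ← Timed.add S.s v
  let w ← newtonSteps P S.Hinv s (P.mNewton - 1) S.w
  let δ ← Timed.sub w S.u
  let r ← Timed.norm S.H δ
  let q ← Timed.op (41 * P.M)
  let θ ← Timed.op (1 / q)
  let close ← Timed.le r θ
  if close then
    return { w := w, u := S.u, H := S.H, Hinv := S.Hinv, s := s }
  else do
    let R ← P.hessOracle w
    return { w := w, u := w, H := R.1, Hinv := R.2, s := s }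

/-- The first `t` rounds, where `g 0, g 1, …` are the subgradients observed. -/
def run {d : ℕ} (P : Input d) (g : ℕ → Vec d) : ℕ → Timed (State d)
  | 0 => init P
  | t + 1 => do
    let S ← run P g t
    round P (g t) S

/-- The iterate played in round `t`. Rounds are numbered `0, 1, …, T - 1`. It depends only on
`g 0, …, g (t - 1)`, so that an arbitrary sequence `g` covers adaptive adversaries. -/
def iterate {d : ℕ} (P : Input d) (g : ℕ → Vec d) (t : ℕ) : Vec d := (run P g t).val.w

/-- The number of elementary operations in `T` rounds, oracle calls included. -/
def totalCost {d : ℕ} (P : Input d) (g : ℕ → Vec d) (T : ℕ) : ℕ := (run P g T).cost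

/-- The regret after `T` rounds with losses `l 0, …, l (T - 1)` against the comparator `w`. -/
def regret {d : ℕ} (P : Input d) (g : ℕ → Vec d) (l : ℕ → Vec d → ℝ) (T : ℕ) (w : Vec d) : ℝ :=
  ∑ t ∈ Finset.range T, l t (iterate P g t) - ∑ t ∈ Finset.range T, l t w

end

end Barons

/-! The iterates shadow follow-the-regularized-leader. Let z_t minimize Φ + ⟨s_t, ·⟩ over the
interior. The invariant (`Invariant`) says that, in the norm ‖·‖_H of the current landmark u, the
iterate w is within 1/(41M) of u and within 3ε of z. By self-concordance (`hessForm_stable`), H is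
comparable to the Hessian of Φ throughout the ball of radius 1/(30M) around u (`near`). Hence, near
u, Φ is strongly convex, and adding ηg to the linear term moves the minimizer by at most 7/4·ηb
(`minimizer_move`). Moreover, a Newton step with the frozen matrix H⁻¹ and ε-accurate gradients
contracts the distance to the minimizer by 1/3, up to an error 7/6·ε (`newton_step`).
Logarithmically many steps therefore restore the invariant (`round_spec`).

Regret: ⟨g_t, w_t - w⟩ is split at z_t and z_{t+1}. The tracking error is O(bε), the stability term
is O(ηb²), and `be_the_leader` bounds the sum of the rest by (Φ(w) - Φ(w⋆))/η. This is at most ν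
log(1/c)/η, because a barrier grows only logarithmically on the way to the boundary (`growth`). The
choice of η and ε balances these terms.

Cost: the potential 41M‖w - u‖_H grows by at most 41M(5ε + 2ηb) in a round; it has passed 1 whenever
the landmark moves, and is then reset to 0. So the Hessian calls after the first number at most the
total growth. The first call is absorbed using M√ν ≥ 1 (`one_le_mul_sqrt`), which holds for every
barrier on a bounded domain of positive dimension. -/

namespace Barons

/-! ### Seminorms of positive semidefinite bilinear forms. -/

section Forms

variable {E : Type*} [AddCommGroup E] [Module ℝ E]

/-- The seminorm `√(B(u,u))` of a positive semidefinite bilinear form. -/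
noncomputable def formNorm (B : LinearMap.BilinForm ℝ E) (u : E) : ℝ := Real.sqrt (B u u)

/-- Symmetric and positive semidefinite. -/
structure IsPsd (B : LinearMap.BilinForm ℝ E) : Prop where
  symm : ∀ u v, B u v = B v u
  nonneg : ∀ u, 0 ≤ B u u

variable {B D : LinearMap.BilinForm ℝ E}

lemma formNorm_nonneg (u : E) : 0 ≤ formNorm B u := Real.sqrt_nonneg _

lemma formNorm_zero : formNorm B 0 = 0 := by simp [formNorm]

lemma IsPsd.sq_formNorm (hB : IsPsd B) (u : E) : formNorm B u ^ 2 = B u u :=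
  Real.sq_sqrt (hB.nonneg u)

lemma formNorm_smul (r : ℝ) (u : E) : formNorm B (r • u) = |r| * formNorm B u := by
  have : B (r • u) (r • u) = r ^ 2 * B u u := by simp; ring
  rw [formNorm, this, Real.sqrt_mul (sq_nonneg r), Real.sqrt_sq_eq_abs, formNorm]

lemma formNorm_neg (u : E) : formNorm B (-u) = formNorm B u := by simp [formNorm]

lemma formNorm_sub_comm (u v : E) : formNorm B (u - v) = formNorm B (v - u) := by
  rw [← neg_sub, formNorm_neg]

/-- A symmetric form dominated on the diagonal by `δ B` is dominated by `δ ‖u‖ ‖v‖`. -/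
lemma IsPsd.abs_apply_le_of_diag (hB : IsPsd B) (hD : ∀ u v, D u v = D v u) {δ : ℝ}
    (h : ∀ u, |D u u| ≤ δ * B u u) (u v : E) :
    |D u v| ≤ δ * (formNorm B u * formNorm B v) := by
  -- Subtracting the diagonal bounds at u + sv and u - sv isolates the cross term; the discriminant
  -- of the resulting quadratic in t gives Cauchy–Schwarz.
  have key : ∀ t : ℝ, 0 ≤ δ * B u u - t * (2 * |D u v|) + t ^ 2 * (δ * B v v) := by
    intro t
    have hp : ∀ s : ℝ, s ^ 2 = t ^ 2 → 4 * (s * D u v) ≤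
        2 * (δ * B u u) + 2 * (t ^ 2 * (δ * B v v)) := by
      intro s hs
      have h1 := h (u + s • v)
      have h2 := h (u - s • v)
      have e1 : D (u + s • v) (u + s • v) = D u u + 2 * (s * D u v) + t ^ 2 * D v v := by
        simp [hD v u]; rw [← hs]; ring
      have e2 : D (u - s • v) (u - s • v) = D u u - 2 * (s * D u v) + t ^ 2 * D v v := by
        simp [hD v u]; rw [← hs]; ring
      have e3 : B (u + s • v) (u + s • v) = B u u + 2 * (s * B u v) + t ^ 2 * B v v := by
        simp [hB.symm v u]; rw [← hs]; ring
      have e4 : B (u - s • v) (u - s • v) = B u u - 2 * (s * B u v) + t ^ 2 * B v v := by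
        simp [hB.symm v u]; rw [← hs]; ring
      rw [e1, e3] at h1
      rw [e2, e4] at h2
      have := (abs_le.1 h1).2
      have := (abs_le.1 h2).1
      linarith
    rcases abs_cases (D u v) with ⟨ha, _⟩ | ⟨ha, _⟩
    · rw [ha]; linarith [hp t rfl]
    · rw [ha]; linarith [hp (-t) (by ring)]
  have hu0 : 0 ≤ δ * B u u := (abs_nonneg _).trans (h u)
  have hv0 : 0 ≤ δ * B v v := (abs_nonneg _).trans (h v)
  have hdisc : |D u v| ^ 2 ≤ (δ * B u u) * (δ * B v v) := by
    have := discrim_le_zero (a := δ * B v v) (b := -(2 * |D u v|)) (c := δ * B u u)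
      (fun t => by linarith [key t])
    rw [discrim] at this
    linarith
  rcases le_or_gt 0 δ with hδ | hδ
  · refine abs_le_of_sq_le_sq' ?_ (by positivity [formNorm_nonneg (B := B) u, formNorm_nonneg (B := B) v]) |>.2
    rw [mul_pow, mul_pow, hB.sq_formNorm, hB.sq_formNorm]
    linarith
  -- A negative δ is compatible with the diagonal bound only if B vanishes on the diagonal.
  · have hu : B u u = 0 := by nlinarith [hB.nonneg u]
    have hv : formNorm B u = 0 := by rw [formNorm, hu, Real.sqrt_zero]
    rw [hu] at hdisc
    rw [hv]
    nlinarith [abs_nonneg (D u v)]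

lemma IsPsd.abs_apply_le (hB : IsPsd B) (u v : E) : |B u v| ≤ formNorm B u * formNorm B v := by
  simpa using hB.abs_apply_le_of_diag hB.symm (δ := 1)
    (fun u => by rw [one_mul, abs_of_nonneg (hB.nonneg u)]) u v

lemma IsPsd.formNorm_add_le (hB : IsPsd B) (u v : E) :
    formNorm B (u + v) ≤ formNorm B u + formNorm B v := by
  refine Real.sqrt_le_iff.2 ⟨add_nonneg (formNorm_nonneg u) (formNorm_nonneg v), ?_⟩
  have e : B (u + v) (u + v) = B u u + 2 * B u v + B v v := by
    simp [hB.symm v u]; ring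
  have := (abs_le.1 (hB.abs_apply_le u v)).2
  rw [e, ← hB.sq_formNorm, ← hB.sq_formNorm]
  nlinarith

lemma IsPsd.formNorm_sub_le (hB : IsPsd B) (u v w : E) :
    formNorm B (u - w) ≤ formNorm B (u - v) + formNorm B (v - w) := by
  simpa using hB.formNorm_add_le (u - v) (v - w)

lemma formNorm_le_mul {κ : ℝ} (hκ : 0 ≤ κ) {u : E} (h : D u u ≤ κ ^ 2 * B u u) :
    formNorm D u ≤ κ * formNorm B u := by
  calc formNorm D u ≤ Real.sqrt (κ ^ 2 * B u u) := Real.sqrt_le_sqrt h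
    _ = κ * formNorm B u := by rw [Real.sqrt_mul (sq_nonneg κ), Real.sqrt_sq hκ, formNorm]

end Forms

/-! ### Matrices as bilinear forms, and dual norms. -/

section Matrices

variable {d : ℕ}

/-- The bilinear form `uᵀ A v`. -/
noncomputable def matForm (A : Mat d) : LinearMap.BilinForm ℝ (Vec d) :=
  (Matrix.toBilin' A).comp (WithLp.linearEquiv 2 ℝ (Fin d → ℝ)).toLinearMap
    (WithLp.linearEquiv 2 ℝ (Fin d → ℝ)).toLinearMap

lemma matForm_apply (A : Mat d) (u v : Vec d) :
    matForm A u v = u.ofLp ⬝ᵥ A.mulVec v.ofLp := by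
  simp [matForm, Matrix.toBilin'_apply']

lemma quadForm_eq (A : Mat d) (u : Vec d) : quadForm A u = matForm A u u := by
  rw [matForm_apply]; rfl

lemma localNorm_eq (A : Mat d) (u : Vec d) : localNorm A u = formNorm (matForm A) u := by
  rw [localNorm, quadForm_eq]; rfl

lemma matForm_symm {A : Mat d} (hA : A.IsSymm) (u v : Vec d) : matForm A u v = matForm A v u := by
  rw [matForm_apply, matForm_apply, Matrix.dotProduct_mulVec, dotProduct_comm,
    ← Matrix.mulVec_transpose, hA.eq]

lemma matForm_sub (A B : Mat d) : matForm (A - B) = matForm A - matForm B := by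
  ext u v; simp [matForm_apply, Matrix.sub_mulVec]

lemma matForm_smul (r : ℝ) (A : Mat d) : matForm (r • A) = r • matForm A := by
  ext u v; simp [matForm_apply, Matrix.smul_mulVec]

lemma Loewner.form_le {A B : Mat d} (h : Loewner A B) (u : Vec d) :
    matForm A u u ≤ matForm B u u := by
  have h1 := h.dotProduct_mulVec_nonneg u.ofLp
  have h2 : matForm (B - A) u u = matForm B u u - matForm A u u := by
    rw [matForm_sub]; rfl
  rw [matForm_apply] at h2
  simp only [star_trivial] at h1
  linarith

lemma Loewner.sub_isSymm {A B : Mat d} (h : Loewner A B) : (B - A).IsSymm := by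
  have := h.1.eq
  rwa [Matrix.conjTranspose_eq_transpose_of_trivial] at this

lemma inner_eq_dotProduct (u v : Vec d) : inner ℝ u v = u.ofLp ⬝ᵥ v.ofLp := by
  rw [EuclideanSpace.inner_eq_star_dotProduct, star_trivial, dotProduct_comm]

lemma matForm_mulVec {H R : Mat d} (h : H * R = 1) (u v : Vec d) :
    matForm H u (WithLp.toLp 2 (R.mulVec v.ofLp)) = inner ℝ u v := by
  rw [matForm_apply, inner_eq_dotProduct]
  simp [Matrix.mulVec_mulVec, h]

lemma isUnit_det_of_form_pos {A : Mat d} (h : ∀ u, u ≠ 0 → 0 < matForm A u u) :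
    IsUnit A.det := by
  rw [isUnit_iff_ne_zero]
  intro h0
  obtain ⟨v, hv, hv0⟩ := Matrix.exists_mulVec_eq_zero_iff.2 h0
  have := h (WithLp.toLp 2 v) (fun hh => hv (by simpa using hh))
  rw [matForm_apply] at this
  simp [hv0] at this

/-- Cauchy–Schwarz between a norm and its dual norm. -/
lemma abs_inner_le_localNorm_inv {A : Mat d} (hA : A.IsSymm)
    (hpos : ∀ u, u ≠ 0 → 0 < matForm A u u) (g u : Vec d) :
    |inner ℝ g u| ≤ localNorm A⁻¹ g * formNorm (matForm A) u := by
  have hP : IsPsd (matForm A) := ⟨matForm_symm hA, fun u => by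
    rcases eq_or_ne u 0 with rfl | h
    · simp
    · exact (hpos u h).le⟩
  have hinv : A * A⁻¹ = 1 := Matrix.mul_nonsing_inv A (isUnit_det_of_form_pos hpos)
  -- The Riesz representative of g for the form A; its A-norm is the dual norm of g.
  set p : Vec d := WithLp.toLp 2 (A⁻¹.mulVec g.ofLp) with hp
  have h1 : matForm A u p = inner ℝ g u := by rw [matForm_mulVec hinv, real_inner_comm]
  have h2 : localNorm A⁻¹ g = formNorm (matForm A) p := by
    rw [localNorm, formNorm, matForm_mulVec hinv, inner_eq_dotProduct, quadForm, hp, dotProduct_comm]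
  rw [← h1, h2, mul_comm]
  exact hP.abs_apply_le u p

end Matrices

end Barons

namespace Barons

/-! ### Derivatives up to order three along lines. -/

section Calculus

variable {E : Type*} [NormedAddCommGroup E] [NormedSpace ℝ E]

/-- The Hessian of `f` at `x` as a bilinear form. -/
noncomputable def hessForm (f : E → ℝ) (x : E) : LinearMap.BilinForm ℝ E :=
  (fderiv ℝ (fderiv ℝ f) x).toBilinForm

/-- The third derivative of `f` at `x`, in the directions `h`, `u`, `v`. -/
noncomputable def thirdForm (f : E → ℝ) (x h u v : E) : ℝ :=
  fderiv ℝ (fderiv ℝ (fderiv ℝ f)) x h u v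

lemma hessForm_apply (f : E → ℝ) (x u v : E) : hessForm f x u v = fderiv ℝ (fderiv ℝ f) x u v := rfl

lemma iteratedFDeriv_three_apply (f : E → ℝ) (x u : E) :
    iteratedFDeriv ℝ 3 f x (fun _ => u) = thirdForm f x u u u := by
  rw [iteratedFDeriv_succ_apply_right, iteratedFDeriv_two_apply]
  rfl

lemma HasFDerivAt.hasDerivAt_line {F : Type*} [NormedAddCommGroup F] [NormedSpace ℝ F] {G : E → F}
    {G' : E →L[ℝ] F} {x h : E} {t : ℝ} (hG : HasFDerivAt G G' (x + t • h)) :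
    HasDerivAt (fun t : ℝ => G (x + t • h)) (G' h) t := by
  have h2 : HasDerivAt (fun t : ℝ => x + t • h) h t := by
    simpa using ((hasDerivAt_id t).smul_const h).const_add x
  exact hG.comp_hasDerivAt t h2

lemma HasDerivAt.eval {F : Type*} [NormedAddCommGroup F] [NormedSpace ℝ F] {c : ℝ → E →L[ℝ] F}
    {c' : E →L[ℝ] F} {t : ℝ} (hc : HasDerivAt c c' t) (u : E) :
    HasDerivAt (fun t => c t u) (c' u) t :=
  (ContinuousLinearMap.apply ℝ F u).hasFDerivAt.comp_hasDerivAt t hc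

variable {f : E → ℝ} {U : Set E} (hU : IsOpen U) (hf : ContDiffOn ℝ 3 f U)
include hU hf

lemma contDiffOn_fderiv : ContDiffOn ℝ 2 (fderiv ℝ f) U :=
  hf.fderiv_of_isOpen hU (by norm_num)

lemma contDiffOn_fderiv_fderiv : ContDiffOn ℝ 1 (fderiv ℝ (fderiv ℝ f)) U :=
  (contDiffOn_fderiv hU hf).fderiv_of_isOpen hU (by norm_num)

lemma hasDerivAt_line {x h : E} {t : ℝ} (ht : x + t • h ∈ U) :
    HasDerivAt (fun t : ℝ => f (x + t • h)) (fderiv ℝ f (x + t • h) h) t := by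
  have h1 : HasFDerivAt f (fderiv ℝ f (x + t • h)) (x + t • h) :=
    ((hf.contDiffAt (hU.mem_nhds ht)).differentiableAt (by norm_num)).hasFDerivAt
  exact HasFDerivAt.hasDerivAt_line h1

lemma hasDerivAt_fderiv_line {x h : E} (u : E) {t : ℝ} (ht : x + t • h ∈ U) :
    HasDerivAt (fun t : ℝ => fderiv ℝ f (x + t • h) u) (hessForm f (x + t • h) h u) t := by
  have h1 : HasFDerivAt (fderiv ℝ f) (fderiv ℝ (fderiv ℝ f) (x + t • h)) (x + t • h) :=
    (((contDiffOn_fderiv hU hf).contDiffAt (hU.mem_nhds ht)).differentiableAt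
      (by norm_num)).hasFDerivAt
  exact HasDerivAt.eval (HasFDerivAt.hasDerivAt_line h1) u

lemma hasFDerivAt_fderiv_fderiv {x : E} (hx : x ∈ U) :
    HasFDerivAt (fderiv ℝ (fderiv ℝ f)) (fderiv ℝ (fderiv ℝ (fderiv ℝ f)) x) x :=
  (((contDiffOn_fderiv_fderiv hU hf).contDiffAt (hU.mem_nhds hx)).differentiableAt
      one_ne_zero).hasFDerivAt

lemma hasDerivAt_fderiv_fderiv_line {x h : E} {t : ℝ} (ht : x + t • h ∈ U) :
    HasDerivAt (fun t : ℝ => fderiv ℝ (fderiv ℝ f) (x + t • h))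
      (fderiv ℝ (fderiv ℝ (fderiv ℝ f)) (x + t • h) h) t :=
  HasFDerivAt.hasDerivAt_line (G := fderiv ℝ (fderiv ℝ f)) (x := x) (h := h)
    (hasFDerivAt_fderiv_fderiv hU hf ht)

lemma hasDerivAt_fderiv_fderiv_line_apply {x h : E} (u : E) {t : ℝ} (ht : x + t • h ∈ U) :
    HasDerivAt (fun t : ℝ => fderiv ℝ (fderiv ℝ f) (x + t • h) u)
      (fderiv ℝ (fderiv ℝ (fderiv ℝ f)) (x + t • h) h u) t :=
  HasDerivAt.eval (hasDerivAt_fderiv_fderiv_line hU hf ht) u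

lemma hasDerivAt_hessForm_line {x h : E} (u v : E) {t : ℝ} (ht : x + t • h ∈ U) :
    HasDerivAt (fun t : ℝ => hessForm f (x + t • h) u v) (thirdForm f (x + t • h) h u v) t :=
  HasDerivAt.eval (hasDerivAt_fderiv_fderiv_line_apply hU hf u ht) v

lemma hessForm_symm {x : E} (hx : x ∈ U) (u v : E) : hessForm f x u v = hessForm f x v u :=
  ((hf.contDiffAt (hU.mem_nhds hx)).isSymmSndFDerivAt (by simp; norm_num)).eq u v

lemma thirdForm_symm_left {x : E} (hx : x ∈ U) (h u v : E) :
    thirdForm f x h u v = thirdForm f x u h v := by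
  have h1 := (((contDiffOn_fderiv hU hf).contDiffAt (hU.mem_nhds hx)).isSymmSndFDerivAt
    (by simp)).eq h u
  exact congrArg (fun L : E →L[ℝ] ℝ => L v) h1

/-- The second derivative is symmetric at all nearby points of the line, so its derivative along the
line is symmetric too. -/
lemma thirdForm_symm_right {x : E} (hx : x ∈ U) (h u v : E) :
    thirdForm f x h u v = thirdForm f x h v u := by
  have hx0 : x + (0 : ℝ) • h ∈ U := by simpa using hx
  have h1 := hasDerivAt_hessForm_line hU hf (h := h) u v hx0
  have h2 := hasDerivAt_hessForm_line hU hf (h := h) v u hx0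
  have hc : ContinuousAt (fun t : ℝ => x + t • h) 0 := by fun_prop
  have he : (fun t : ℝ => hessForm f (x + t • h) u v) =ᶠ[nhds 0]
      fun t : ℝ => hessForm f (x + t • h) v u := by
    filter_upwards [hc.preimage_mem_nhds (hU.mem_nhds hx0)] with t ht
    exact hessForm_symm hU hf ht u v
  have := h1.unique (h2.congr_of_eventuallyEq he)
  simpa using this

/-- Expand both cubes: the terms even in h cancel in the difference. -/
lemma thirdForm_polarization {x : E} (hx : x ∈ U) (h u : E) :
    6 * thirdForm f x h u u = thirdForm f x (u + h) (u + h) (u + h)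
      - thirdForm f x (u - h) (u - h) (u - h) - 2 * thirdForm f x h h h := by
  have s1 := thirdForm_symm_left hU hf hx u h u
  have s2 := thirdForm_symm_right hU hf hx u h u
  have s3 := thirdForm_symm_right hU hf hx h u h
  have s4 := thirdForm_symm_left hU hf hx u h h
  simp only [thirdForm, map_add, map_sub, add_apply, sub_apply] at *
  linarith

end Calculus

/-! ### The Hessian matrix and the second derivative. -/

section Hessian

variable {d : ℕ}

lemma matForm_hessian (f : Vec d → ℝ) (x : Vec d) : matForm (hessian f x) = hessForm f x := by
  refine LinearMap.BilinForm.ext_basis (EuclideanSpace.basisFun (Fin d) ℝ).toBasis fun i j => ?_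
  rw [matForm_apply, hessForm_apply]
  simp [hessian, iteratedFDeriv_two_apply]

lemma localNorm_hessian (f : Vec d → ℝ) (x u : Vec d) :
    localNorm (hessian f x) u = formNorm (hessForm f x) u := by
  rw [localNorm_eq, matForm_hessian]

lemma hessian_isSymm {f : Vec d → ℝ} {U : Set (Vec d)} (hU : IsOpen U) (hf : ContDiffOn ℝ 3 f U)
    {x : Vec d} (hx : x ∈ U) : (hessian f x).IsSymm := by
  ext i j
  simp only [Matrix.transpose_apply, hessian, Matrix.of_apply, iteratedFDeriv_two_apply]
  exact hessForm_symm hU hf hx _ _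

end Hessian

end Barons

open Set Filter Topology

/-! ### Rays leaving the domain, and convexity of self-concordant functions. -/

namespace Barons

/-- The tool for integrating differential inequalities below: each use is a choice of a monotone
auxiliary function φ. -/
lemma le_of_hasDerivAt_nonneg {φ φ' : ℝ → ℝ} {a b : ℝ} (hab : a ≤ b)
    (h : ∀ t ∈ Icc a b, HasDerivAt φ (φ' t) t) (h0 : ∀ t ∈ Icc a b, 0 ≤ φ' t) : φ a ≤ φ b := by
  have : MonotoneOn φ (Icc a b) := by
    refine monotoneOn_of_deriv_nonneg (convex_Icc a b)
      (fun t ht => (h t ht).continuousAt.continuousWithinAt)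
      (fun t ht => (h t (interior_subset ht)).differentiableAt.differentiableWithinAt)
      (fun t ht => ?_)
    rw [(h t (interior_subset ht)).deriv]
    exact h0 t (interior_subset ht)
  exact this (left_mem_Icc.2 hab) (right_mem_Icc.2 hab) hab

section Paths

variable {E : Type*} [NormedAddCommGroup E] [NormedSpace ℝ E] {K : Set E} {x u : E}

/-- The exit times form a closed set of nonnegative reals not containing 0, so their infimum is
attained and positive; the exit point is a limit of interior points. -/
lemma exists_first_exit (hx : x ∈ interior K) {T : ℝ} (hT : 0 ≤ T)
    (hxT : x + T • u ∉ interior K) :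
    ∃ τ : ℝ, 0 < τ ∧ τ ≤ T ∧ (∀ t ∈ Ico 0 τ, x + t • u ∈ interior K) ∧ x + τ • u ∈ frontier K := by
  set S : Set ℝ := Ici 0 ∩ (fun t : ℝ => x + t • u) ⁻¹' (interior K)ᶜ with hS
  have hcont : Continuous fun t : ℝ => x + t • u := by fun_prop
  have hSc : IsClosed S := isClosed_Ici.inter (isOpen_interior.isClosed_compl.preimage hcont)
  have hTS : T ∈ S := ⟨hT, hxT⟩
  have hbdd : BddBelow S := ⟨0, fun t ht => ht.1⟩
  have hmem : sInf S ∈ S := hSc.csInf_mem ⟨T, hTS⟩ hbdd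
  have hpos : 0 < sInf S := by
    refine lt_of_le_of_ne hmem.1 fun h => hmem.2 ?_
    rw [← h]; simpa using hx
  have hin : ∀ t ∈ Ico 0 (sInf S), x + t • u ∈ interior K := by
    intro t ht
    by_contra hc
    exact absurd (csInf_le hbdd ⟨ht.1, hc⟩) (not_le.2 ht.2)
  refine ⟨sInf S, hpos, csInf_le hbdd hTS, hin, ?_, hmem.2⟩
  have htend : Tendsto (fun t : ℝ => x + t • u) (𝓝[<] (sInf S)) (𝓝 (x + sInf S • u)) :=
    hcont.continuousAt.tendsto.mono_left nhdsWithin_le_nhds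
  refine mem_closure_of_tendsto htend ?_
  filter_upwards [Ioo_mem_nhdsLT hpos] with t ht
  exact interior_subset (hin t ⟨ht.1.le, ht.2⟩)

lemma exists_exit (hK : IsCompact K) (hx : x ∈ interior K) (hu : u ≠ 0) :
    ∃ τ : ℝ, 0 < τ ∧ (∀ t ∈ Ico 0 τ, x + t • u ∈ interior K) ∧ x + τ • u ∈ frontier K := by
  obtain ⟨R, hR⟩ := hK.isBounded.exists_norm_le
  have hun : 0 < ‖u‖ := norm_pos_iff.2 hu
  have hR0 : 0 ≤ R := (norm_nonneg x).trans (hR x (interior_subset hx))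
  obtain ⟨τ, h1, -, h2, h3⟩ := exists_first_exit (u := u) hx
    (T := (2 * R + 1) / ‖u‖) (by positivity) (fun hc => by
      have h1 := hR _ (interior_subset hc)
      have h2 := norm_le_norm_add_norm_sub' (((2 * R + 1) / ‖u‖) • u) (-x)
      have h3 := hR _ (interior_subset hx)
      rw [norm_smul, Real.norm_of_nonneg (by positivity), div_mul_cancel₀ _ hun.ne', norm_neg,
        sub_neg_eq_add, add_comm _ x] at h2
      linarith)
  exact ⟨τ, h1, h2, h3⟩

lemma exists_large_of_exit {f : E → ℝ}
    (hf : ∀ y ∈ frontier K, Tendsto f (𝓝[interior K] y) atTop) {τ : ℝ} (hτ : 0 < τ)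
    (hin : ∀ t ∈ Ico 0 τ, x + t • u ∈ interior K) (hout : x + τ • u ∈ frontier K) (C t₀ : ℝ)
    (ht₀ : t₀ < τ) : ∃ t ∈ Ico 0 τ, t₀ < t ∧ C < f (x + t • u) := by
  have hcont : Continuous fun t : ℝ => x + t • u := by fun_prop
  have htend : Tendsto (fun t : ℝ => x + t • u) (𝓝[<] τ) (𝓝[interior K] (x + τ • u)) := by
    refine tendsto_nhdsWithin_iff.2
      ⟨hcont.continuousAt.tendsto.mono_left nhdsWithin_le_nhds, ?_⟩
    filter_upwards [Ioo_mem_nhdsLT hτ] with t ht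
    exact hin t ⟨ht.1.le, ht.2⟩
  have h := ((hf _ hout).comp htend).eventually_gt_atTop C
  have h' : ∀ᶠ t in 𝓝[<] τ, t ∈ Ioo 0 τ := Ioo_mem_nhdsLT hτ
  have h'' : ∀ᶠ t in 𝓝[<] τ, t ∈ Ioo t₀ τ := Ioo_mem_nhdsLT ht₀
  obtain ⟨t, h1, h2, h3⟩ := (h.and (h'.and h'')).exists
  exact ⟨t, ⟨h2.1.le, h2.2⟩, h3.1, h1⟩

lemma segment_mem_interior (hK : Convex ℝ K) (hx : x ∈ interior K) (hy : x + u ∈ interior K)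
    {t : ℝ} (ht : t ∈ Icc (0 : ℝ) 1) : x + t • u ∈ interior K := by
  have := hK.interior.add_smul_mem hx hy ht
  exact this

end Paths

variable {d : ℕ} {K : Set (Vec d)} {f : Vec d → ℝ} {M : ℝ}

namespace IsSelfConcordant

lemma hessForm_symm (hsc : IsSelfConcordant K f M) {x : Vec d} (hx : x ∈ interior K)
    (u v : Vec d) : hessForm f x u v = hessForm f x v u :=
  Barons.hessForm_symm isOpen_interior hsc.smooth hx u v

/-- Adding the tangent inequalities at two points of a line shows that the directional derivative
increases along it, and the Hessian form is a limit of its difference quotients. -/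
lemma hessForm_nonneg (hsc : IsSelfConcordant K f M) {x : Vec d} (hx : x ∈ interior K)
    (u : Vec d) : 0 ≤ hessForm f x u u := by
  have hfd : ∀ y ∈ interior K, ∀ z ∈ interior K, fderiv ℝ f y (z - y) ≤ f z - f y := by
    intro y hy z hz
    have h0 : y + (0 : ℝ) • (z - y) ∈ interior K := by simpa using hy
    have hd := hasDerivAt_line isOpen_interior hsc.smooth (h := z - y) h0
    have hc : ConvexOn ℝ (Icc (0 : ℝ) 1) fun t : ℝ => f (y + t • (z - y)) := by
      have := hsc.convex.comp_affineMap (AffineMap.lineMap y z)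
      refine (this.subset ?_ (convex_Icc 0 1)).congr ?_
      · intro t ht
        have : y + t • (z - y) ∈ interior K :=
          hsc.convex.1.add_smul_sub_mem hy hz ht
        simpa [AffineMap.lineMap_apply, add_comm] using this
      · intro t _
        simp [AffineMap.lineMap_apply, add_comm]
    have := hc.le_slope_of_hasDerivAt (left_mem_Icc.2 zero_le_one) (right_mem_Icc.2 zero_le_one)
      zero_lt_one hd
    simpa [slope_def_field] using this
  have hx0 : x + (0 : ℝ) • u ∈ interior K := by simpa using hx
  have hd := hasDerivAt_fderiv_line isOpen_interior hsc.smooth (h := u) u hx0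
  rw [zero_smul, add_zero] at hd
  have hcont : Continuous fun t : ℝ => x + t • u := by fun_prop
  have hmem : ∀ᶠ t in 𝓝[>] (0 : ℝ), x + t • u ∈ interior K :=
    nhdsWithin_le_nhds (hcont.continuousAt.preimage_mem_nhds (isOpen_interior.mem_nhds hx0))
  have hright : 𝓝[>] (0 : ℝ) ≤ 𝓝[≠] 0 := nhdsWithin_mono 0 fun t (ht : 0 < t) => ht.ne'
  refine ge_of_tendsto (hd.tendsto_slope.mono_left hright) ?_
  filter_upwards [hmem, self_mem_nhdsWithin] with t ht ht0
  have ht0 : 0 < t := ht0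
  have h1 := hfd _ hx _ ht
  have h2 := hfd _ ht _ hx
  have e1 : x + t • u - x = t • u := by abel
  have e2 : x - (x + t • u) = -(t • u) := by abel
  rw [e1, map_smul, smul_eq_mul] at h1
  rw [e2, map_neg, map_smul, smul_eq_mul] at h2
  rw [slope_def_field]
  simp only [zero_smul, add_zero, sub_zero]
  exact div_nonneg (by nlinarith) ht0.le

lemma isPsd (hsc : IsSelfConcordant K f M) {x : Vec d} (hx : x ∈ interior K) :
    IsPsd (hessForm f x) :=
  ⟨hsc.hessForm_symm hx, hsc.hessForm_nonneg hx⟩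

lemma thirdForm_diag_le (hsc : IsSelfConcordant K f M) {x : Vec d} (hx : x ∈ interior K)
    (u : Vec d) : |thirdForm f x u u u| ≤ 2 * M * formNorm (hessForm f x) u ^ 3 := by
  have := hsc.third_le x hx u
  rwa [iteratedFDeriv_three_apply, localNorm_hessian] at this

end IsSelfConcordant

end Barons

/-! ### Self-concordance: nondegeneracy, Dikin ellipsoid, Hessian stability. -/

namespace Barons

variable {d : ℕ} {K : Set (Vec d)} {f : Vec d → ℝ} {M : ℝ}

namespace IsSelfConcordant

section OnPath

variable (hsc : IsSelfConcordant K f M) {x h : Vec d} {t : ℝ} (ht : x + t • h ∈ interior K)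
include hsc ht

lemma deriv_line : HasDerivAt (fun t : ℝ => f (x + t • h)) (fderiv ℝ f (x + t • h) h) t :=
  hasDerivAt_line isOpen_interior hsc.smooth ht

lemma deriv_fderiv_line (u : Vec d) :
    HasDerivAt (fun t : ℝ => fderiv ℝ f (x + t • h) u) (hessForm f (x + t • h) h u) t :=
  hasDerivAt_fderiv_line isOpen_interior hsc.smooth u ht

lemma deriv_hessForm_line (u v : Vec d) :
    HasDerivAt (fun t : ℝ => hessForm f (x + t • h) u v) (thirdForm f (x + t • h) h u v) t :=
  hasDerivAt_hessForm_line isOpen_interior hsc.smooth u v ht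

end OnPath

/-- Bounds on the first derivative along a path bound the function along the path. -/
lemma not_exit_of_bdd (hsc : IsSelfConcordant K f M) {x h : Vec d} {τ C : ℝ} (hτ : 0 < τ)
    (hin : ∀ t ∈ Ico 0 τ, x + t • h ∈ interior K) (hout : x + τ • h ∈ frontier K)
    (hC : ∀ t ∈ Ico 0 τ, fderiv ℝ f (x + t • h) h ≤ C) : False := by
  obtain ⟨t, ht, -, hlt⟩ :=
    exists_large_of_exit hsc.blowup hτ hin hout (f x + |C| * τ) 0 hτ
  have hsub : ∀ s ∈ Icc 0 t, s ∈ Ico 0 τ := fun s hs => ⟨hs.1, hs.2.trans_lt ht.2⟩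
  have := le_of_hasDerivAt_nonneg (φ := fun s => C * s - f (x + s • h)) ht.1
    (fun s hs => ((hasDerivAt_id s).const_mul C).sub (hsc.deriv_line (hin s (hsub s hs))))
    (fun s hs => by
      have := hC s (hsub s hs)
      linarith)
  simp only [mul_zero, zero_smul, add_zero, zero_sub] at this
  have h1 : C * t ≤ |C| * τ :=
    (mul_le_mul_of_nonneg_right (le_abs_self C) ht.1).trans
      (mul_le_mul_of_nonneg_left ht.2.le (abs_nonneg C))
  linarith

/-- The Hessian of a self-concordant function on a bounded domain is positive definite. -/
lemma hessForm_pos (hsc : IsSelfConcordant K f M) (hK : IsCompact K) {x : Vec d}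
    (hx : x ∈ interior K) {u : Vec d} (hu : u ≠ 0) : 0 < hessForm f x u u := by
  refine lt_of_le_of_ne (hsc.hessForm_nonneg hx u) fun h0 => ?_
  obtain ⟨τ, hτ, hin, hout⟩ := exists_exit hK hx hu
  set ψ : ℝ → ℝ := fun t => hessForm f (x + t • u) u u with hψ
  -- On a compact piece of the ray ψ is bounded, so self-concordance gives |ψ'| ≤ const·ψ, and
  -- Grönwall propagates the zero. Then f is affine up to the boundary, contradicting blow-up.
  have hzero : ∀ t ∈ Ico 0 τ, ψ t = 0 := by
    intro t ht
    have hsub : ∀ s ∈ Icc 0 t, s ∈ Ico 0 τ := fun s hs => ⟨hs.1, hs.2.trans_lt ht.2⟩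
    have hd : ∀ s ∈ Icc 0 t, HasDerivAt ψ (thirdForm f (x + s • u) u u u) s := fun s hs =>
      hsc.deriv_hessForm_line (hin s (hsub s hs)) u u
    have hcont : ContinuousOn ψ (Icc 0 t) := fun s hs =>
      (hd s hs).continuousAt.continuousWithinAt
    obtain ⟨C, hC⟩ := isCompact_Icc.exists_bound_of_continuousOn hcont
    have hC0 : 0 ≤ C := (norm_nonneg _).trans (hC 0 (left_mem_Icc.2 ht.1))
    have := norm_le_gronwallBound_of_norm_deriv_right_le (f := ψ) (δ := 0) (ε := 0)
      (K := 2 * M * Real.sqrt C) hcont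
      (fun s hs => (hd s (Ico_subset_Icc_self hs)).hasDerivWithinAt)
      (by simp [hψ, ← h0])
      (fun s hs => by
        have hs' := Ico_subset_Icc_self hs
        have hp := hsc.hessForm_nonneg (hin s (hsub s hs')) u
        have h1 := hsc.thirdForm_diag_le (hin s (hsub s hs')) u
        have h2 := (hsc.isPsd (hin s (hsub s hs'))).sq_formNorm u
        have h3 : formNorm (hessForm f (x + s • u)) u ≤ Real.sqrt C :=
          Real.sqrt_le_sqrt ((le_abs_self _).trans (hC s hs'))
        rw [Real.norm_eq_abs, Real.norm_of_nonneg hp, add_zero]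
        refine h1.trans ?_
        rw [pow_succ, h2, mul_assoc, mul_assoc, mul_assoc]
        have hM := hsc.nonneg
        have : hessForm f (x + s • u) u u * formNorm (hessForm f (x + s • u)) u ≤
            Real.sqrt C * hessForm f (x + s • u) u u := by
          rw [mul_comm]; exact mul_le_mul_of_nonneg_right h3 hp
        gcongr)
      t (right_mem_Icc.2 ht.1)
    rw [gronwallBound_ε0_δ0] at this
    exact norm_le_zero_iff.1 this
  refine hsc.not_exit_of_bdd hτ hin hout (C := fderiv ℝ f x u) fun t ht => ?_
  have hsub : ∀ s ∈ Icc 0 t, s ∈ Ico 0 τ := fun s hs => ⟨hs.1, hs.2.trans_lt ht.2⟩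
  have := le_of_hasDerivAt_nonneg (φ := fun s => -fderiv ℝ f (x + s • u) u) ht.1
    (fun s hs => (hsc.deriv_fderiv_line (hin s (hsub s hs)) u).neg)
    (fun s hs => by
      have := hzero s (hsub s hs)
      simp only [hψ] at this
      rw [this, neg_zero])
  simp only [zero_smul, add_zero] at this
  linarith

lemma formNorm_pos (hsc : IsSelfConcordant K f M) (hK : IsCompact K) {x : Vec d}
    (hx : x ∈ interior K) {u : Vec d} (hu : u ≠ 0) : 0 < formNorm (hessForm f x) u :=
  Real.sqrt_pos.2 (hsc.hessForm_pos hK hx hu)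

/-- The bound on the third derivative in two directions; the factor `3` comes from
polarization. -/
lemma thirdForm_le (hsc : IsSelfConcordant K f M) (hK : IsCompact K) {x : Vec d}
    (hx : x ∈ interior K) (h u : Vec d) :
    |thirdForm f x h u u| ≤ 2 * (3 * M) * formNorm (hessForm f x) h * hessForm f x u u := by
  have hP := hsc.isPsd hx
  have hM := hsc.nonneg
  rcases eq_or_ne h 0 with rfl | hh
  · simp [thirdForm, formNorm_zero]
  rcases eq_or_ne u 0 with rfl | hu
  · simp [thirdForm]
  set n := formNorm (hessForm f x) with hn
  have hnh : 0 < n h := hsc.formNorm_pos hK hx hh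
  have hnu : 0 < n u := hsc.formNorm_pos hK hx hu
  -- For unit vectors u ± h has norm at most 2, so polarization gives 6|·| ≤ 2·(2M·8) + 2·2M = 36M;
  -- homogeneity does the rest.
  have key : ∀ h u : Vec d, n h = 1 → n u = 1 → |thirdForm f x h u u| ≤ 6 * M := by
    intro h u h1 h2
    have hpol := thirdForm_polarization isOpen_interior hsc.smooth hx h u
    have b1 := hsc.thirdForm_diag_le hx (u + h)
    have b2 := hsc.thirdForm_diag_le hx (u - h)
    have b3 := hsc.thirdForm_diag_le hx h
    have c1 : n (u + h) ≤ 2 := by have := hP.formNorm_add_le u h; linarith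
    have c2 : n (u - h) ≤ 2 := by
      have := hP.formNorm_sub_le u 0 h
      rw [sub_zero, zero_sub, formNorm_neg] at this; linarith
    have d1 : n (u + h) ^ 3 ≤ 2 ^ 3 := pow_le_pow_left₀ (formNorm_nonneg _) c1 3
    have d2 : n (u - h) ^ 3 ≤ 2 ^ 3 := pow_le_pow_left₀ (formNorm_nonneg _) c2 3
    have e1 : |thirdForm f x (u + h) (u + h) (u + h)| ≤ 2 * M * 2 ^ 3 :=
      b1.trans (mul_le_mul_of_nonneg_left d1 (by positivity))
    have e2 : |thirdForm f x (u - h) (u - h) (u - h)| ≤ 2 * M * 2 ^ 3 :=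
      b2.trans (mul_le_mul_of_nonneg_left d2 (by positivity))
    rw [← hn, h1] at b3
    rw [abs_le] at *
    constructor <;> linarith [e1.1, e1.2, e2.1, e2.2, b3.1, b3.2]
  have k := key ((n h)⁻¹ • h) ((n u)⁻¹ • u)
    (by rw [hn, formNorm_smul, abs_of_pos (inv_pos.2 hnh), inv_mul_cancel₀ hnh.ne'])
    (by rw [hn, formNorm_smul, abs_of_pos (inv_pos.2 hnu), inv_mul_cancel₀ hnu.ne'])
  have e : thirdForm f x ((n h)⁻¹ • h) ((n u)⁻¹ • u) ((n u)⁻¹ • u) =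
      (n h)⁻¹ * ((n u)⁻¹ * ((n u)⁻¹ * thirdForm f x h u u)) := by
    simp [thirdForm]; ring
  rw [e, abs_mul, abs_mul, abs_mul, abs_of_pos (inv_pos.2 hnh), abs_of_pos (inv_pos.2 hnu)] at k
  rw [← hP.sq_formNorm u, ← hn]
  have : |thirdForm f x h u u| =
      n h * n u ^ 2 * ((n h)⁻¹ * ((n u)⁻¹ * ((n u)⁻¹ * |thirdForm f x h u u|))) := by
    have := hnh.ne'; have := hnu.ne'
    field_simp
  rw [this]
  calc _ ≤ n h * n u ^ 2 * (6 * M) := by gcongr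
    _ = _ := by ring

/-- Along a line, `1 / ‖h‖` is `M`-Lipschitz. -/
lemma inv_formNorm_path (hsc : IsSelfConcordant K f M) (hK : IsCompact K) {x h : Vec d}
    (hh : h ≠ 0) {t : ℝ} (ht : 0 ≤ t) (hin : ∀ s ∈ Icc 0 t, x + s • h ∈ interior K) :
    |(formNorm (hessForm f (x + t • h)) h)⁻¹ - (formNorm (hessForm f x) h)⁻¹| ≤ M * t := by
  set q : ℝ → ℝ := fun s => (formNorm (hessForm f (x + s • h)) h)⁻¹ with hq
  set q' : ℝ → ℝ := fun s => -(thirdForm f (x + s • h) h h h /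
    (2 * formNorm (hessForm f (x + s • h)) h)) / formNorm (hessForm f (x + s • h)) h ^ 2 with hq'
  have hd : ∀ s ∈ Icc 0 t, HasDerivAt q (q' s) s := fun s hs =>
    ((hsc.deriv_hessForm_line (hin s hs) h h).sqrt
      (hsc.hessForm_pos hK (hin s hs) hh).ne').inv (hsc.formNorm_pos hK (hin s hs) hh).ne'
  have hb : ∀ s ∈ Icc 0 t, |q' s| ≤ M := by
    intro s hs
    have hp := hsc.formNorm_pos hK (hin s hs) hh
    have h3 := hsc.thirdForm_diag_le (hin s hs) h
    rw [hq', abs_div, abs_neg, abs_div, abs_of_pos (by positivity : 0 < 2 * formNorm _ h),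
      abs_of_pos (by positivity : 0 < formNorm _ h ^ 2), div_div, div_le_iff₀ (by positivity)]
    calc _ ≤ _ := h3
      _ = _ := by ring
  have h1 := le_of_hasDerivAt_nonneg (φ := fun s => M * s - q s) ht
    (fun s hs => ((hasDerivAt_id s).const_mul M).sub (hd s hs))
    (fun s hs => by have := abs_le.1 (hb s hs); linarith [this.2])
  have h2 := le_of_hasDerivAt_nonneg (φ := fun s => M * s + q s) ht
    (fun s hs => ((hasDerivAt_id s).const_mul M).add (hd s hs))
    (fun s hs => by have := abs_le.1 (hb s hs); linarith [this.1])
  simp only [hq, zero_smul, add_zero, mul_zero, zero_sub, zero_add] at h1 h2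
  rw [abs_le]
  constructor <;> linarith

/-- By the Lipschitz bound, the reciprocal of the norm is still at least 1/r - Mt. -/
lemma formNorm_path_le (hsc : IsSelfConcordant K f M) (hK : IsCompact K) {x h : Vec d}
    {t r : ℝ} (ht : 0 ≤ t) (hin : ∀ s ∈ Icc 0 t, x + s • h ∈ interior K)
    (hr : formNorm (hessForm f x) h ≤ r) (hrt : M * r * t < 1) :
    formNorm (hessForm f (x + t • h)) h ≤ r / (1 - M * r * t) := by
  rcases eq_or_ne h 0 with rfl | hh
  · rw [formNorm_zero] at hr ⊢
    exact div_nonneg hr (by linarith)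
  have hx : x ∈ interior K := by simpa using hin 0 (left_mem_Icc.2 ht)
  have hp := hsc.formNorm_pos hK hx hh
  have hpt := hsc.formNorm_pos hK (hin t (right_mem_Icc.2 ht)) hh
  have hr0 : 0 < r := hp.trans_le hr
  have h1 := (abs_le.1 (hsc.inv_formNorm_path hK hh ht hin)).1
  have h2 : r⁻¹ ≤ (formNorm (hessForm f x) h)⁻¹ := inv_anti₀ hp hr
  have h3 : (1 - M * r * t) / r ≤ (formNorm (hessForm f (x + t • h)) h)⁻¹ := by
    have : (1 - M * r * t) / r = r⁻¹ - M * t := by field_simp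
    rw [this]; linarith
  have := inv_anti₀ (div_pos (by linarith) hr0) h3
  rwa [inv_inv, inv_div] at this

/-- The Dikin ellipsoid lies in the domain. -/
lemma dikin (hsc : IsSelfConcordant K f M) (hK : IsCompact K) {x h : Vec d}
    (hx : x ∈ interior K) (hr : M * formNorm (hessForm f x) h < 1) : x + h ∈ interior K := by
  by_contra hc
  obtain ⟨τ, hτ, hτ1, hin, hout⟩ := exists_first_exit (T := 1) hx zero_le_one (by simpa using hc)
  set r := formNorm (hessForm f x) h with hr'
  have hr0 : 0 ≤ r := formNorm_nonneg _
  have hM := hsc.nonneg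
  -- Before the exit time the second derivative along h is bounded, hence so is the first, and f
  -- cannot blow up.
  have hψ : ∀ t ∈ Ico 0 τ, hessForm f (x + t • h) h h ≤ (r / (1 - M * r)) ^ 2 := by
    intro t ht
    have ht1 : M * r * t ≤ M * r :=
      mul_le_of_le_one_right (by positivity) (ht.2.le.trans hτ1)
    have := hsc.formNorm_path_le hK ht.1
      (fun s hs => hin s ⟨hs.1, hs.2.trans_lt ht.2⟩) le_rfl (by rw [← hr']; linarith)
    rw [← (hsc.isPsd (hin t ht)).sq_formNorm]
    refine pow_le_pow_left₀ (formNorm_nonneg _) (this.trans ?_) 2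
    rw [← hr']
    exact div_le_div_of_nonneg_left hr0 (by linarith) (by linarith)
  refine hsc.not_exit_of_bdd hτ hin hout
    (C := fderiv ℝ f x h + (r / (1 - M * r)) ^ 2 * τ) fun t ht => ?_
  have hsub : ∀ s ∈ Icc 0 t, s ∈ Ico 0 τ := fun s hs => ⟨hs.1, hs.2.trans_lt ht.2⟩
  have := le_of_hasDerivAt_nonneg
    (φ := fun s => (r / (1 - M * r)) ^ 2 * s - fderiv ℝ f (x + s • h) h) ht.1
    (fun s hs => ((hasDerivAt_id s).const_mul _).sub
      (hsc.deriv_fderiv_line (hin s (hsub s hs)) h))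
    (fun s hs => by have := hψ s (hsub s hs); linarith)
  simp only [zero_smul, add_zero, mul_zero, zero_sub] at this
  have h2 : (r / (1 - M * r)) ^ 2 * t ≤ (r / (1 - M * r)) ^ 2 * τ :=
    mul_le_mul_of_nonneg_left ht.2.le (sq_nonneg _)
  linarith

/-- Stability of the Hessian in the Dikin ellipsoid. -/
lemma hessForm_stable (hsc : IsSelfConcordant K f M) (hK : IsCompact K) (hKc : Convex ℝ K)
    {x h : Vec d} (hx : x ∈ interior K) {r : ℝ} (hr : formNorm (hessForm f x) h ≤ r)
    (hr1 : 3 * M * r < 1) (u : Vec d) :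
    hessForm f (x + h) u u * (1 - 3 * M * r) ^ 2 ≤ hessForm f x u u ∧
      hessForm f x u u * (1 - 3 * M * r) ^ 2 ≤ hessForm f (x + h) u u := by
  have hM := hsc.nonneg
  have hr0 : 0 ≤ r := (formNorm_nonneg _).trans hr
  have hMr : 0 ≤ M * r := by positivity
  have hxh : x + h ∈ interior K := hsc.dikin hK hx (by
    have := mul_le_mul_of_nonneg_left hr hM
    linarith)
  have hin : ∀ s ∈ Icc (0 : ℝ) 1, x + s • h ∈ interior K := fun s hs =>
    segment_mem_interior hKc hx hxh hs
  have hden : ∀ s ∈ Icc (0 : ℝ) 1, 0 < 1 - 3 * M * r * s := fun s hs => by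
    have : 3 * M * r * s ≤ 3 * M * r := mul_le_of_le_one_right (by positivity) hs.2
    linarith
  -- With ψ(s) the Hessian form at u and ℓ(s) = 1 - 3Mrs, this reads |ψ'|ℓ ≤ 2(3Mr)ψ. So ψℓ²
  -- decreases and ψ/ℓ² increases, which are the two bounds. The path bound r/(1 - Mrs) is weakened
  -- to r/ℓ to match.
  have hthird : ∀ s ∈ Icc (0 : ℝ) 1, |thirdForm f (x + s • h) h u u| * (1 - 3 * M * r * s) ≤
      2 * (3 * M * r) * hessForm f (x + s • h) u u := by
    intro s hs
    have hMs : 0 ≤ M * r * s := mul_nonneg hMr hs.1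
    have h1 := hsc.thirdForm_le hK (hin s hs) h u
    have h2 := hsc.formNorm_path_le hK hs.1 (fun s' hs' => hin s' ⟨hs'.1, hs'.2.trans hs.2⟩) hr
      (by linarith [hden s hs])
    have h3 : formNorm (hessForm f (x + s • h)) h ≤ r / (1 - 3 * M * r * s) :=
      h2.trans (div_le_div_of_nonneg_left hr0 (hden s hs) (by linarith))
    rw [le_div_iff₀ (hden s hs)] at h3
    have hp := hsc.hessForm_nonneg (hin s hs) u
    calc _ ≤ (2 * (3 * M) * formNorm (hessForm f (x + s • h)) h * hessForm f (x + s • h) u u) *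
          (1 - 3 * M * r * s) := mul_le_mul_of_nonneg_right h1 (hden s hs).le
      _ = 2 * (3 * M) * (formNorm (hessForm f (x + s • h)) h * (1 - 3 * M * r * s)) *
          hessForm f (x + s • h) u u := by ring
      _ ≤ 2 * (3 * M) * r * hessForm f (x + s • h) u u := by gcongr
      _ = _ := by ring
  have hdl : ∀ s : ℝ, HasDerivAt (fun s : ℝ => (1 - 3 * M * r * s) ^ 2)
      (-(2 * (3 * M * r) * (1 - 3 * M * r * s))) s := fun s => by
    have := (((hasDerivAt_id s).const_mul (3 * M * r)).const_sub 1).pow 2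
    refine this.congr_deriv ?_
    norm_num
    ring
  constructor
  · have := le_of_hasDerivAt_nonneg
      (φ := fun s => -(hessForm f (x + s • h) u u * (1 - 3 * M * r * s) ^ 2)) zero_le_one
      (fun s hs => ((hsc.deriv_hessForm_line (hin s hs) u u).mul (hdl s)).neg)
      (fun s hs => by
        have h1 := hthird s hs
        have h2 := le_abs_self (thirdForm f (x + s • h) h u u)
        have h3 := hden s hs
        nlinarith [mul_le_mul_of_nonneg_right h2 h3.le])
    simp only [zero_smul, add_zero, one_smul, mul_zero, mul_one, sub_zero, one_pow] at this
    linarith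
  · have := le_of_hasDerivAt_nonneg
      (φ := fun s => hessForm f (x + s • h) u u / (1 - 3 * M * r * s) ^ 2) zero_le_one
      (fun s hs => (hsc.deriv_hessForm_line (hin s hs) u u).div (hdl s)
        (pow_ne_zero 2 (hden s hs).ne'))
      (fun s hs => by
        have h1 := hthird s hs
        have h2 := neg_abs_le (thirdForm f (x + s • h) h u u)
        have h3 := hden s hs
        refine div_nonneg ?_ (by positivity)
        nlinarith [mul_le_mul_of_nonneg_right h2 h3.le])
    simp only [zero_smul, add_zero, one_smul, mul_zero, mul_one, sub_zero, one_pow, div_one] at this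
    rwa [le_div_iff₀ (pow_pos (by linarith) 2)] at this

end IsSelfConcordant

end Barons

/-! ### Barriers: M√ν ≥ 1, logarithmic growth, existence of minimizers. -/

namespace Barons

variable {d : ℕ} {K : Set (Vec d)} {f : Vec d → ℝ} {M ν : ℝ}

lemma IsSelfConcordant.abs_inner_le (hsc : IsSelfConcordant K f M) (hK : IsCompact K) {x : Vec d}
    (hx : x ∈ interior K) (g u : Vec d) :
    |inner ℝ g u| ≤ localNorm (hessian f x)⁻¹ g * formNorm (hessForm f x) u := by
  have := abs_inner_le_localNorm_inv (hessian_isSymm isOpen_interior hsc.smooth hx)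
    (fun u hu => by rw [matForm_hessian]; exact hsc.hessForm_pos hK hx hu) g u
  rwa [matForm_hessian] at this

namespace IsBarrier

lemma abs_fderiv_le (hb : IsBarrier K f M ν) (hK : IsCompact K) {x : Vec d}
    (hx : x ∈ interior K) (u : Vec d) :
    |fderiv ℝ f x u| ≤ Real.sqrt ν * formNorm (hessForm f x) u := by
  have h := hb.selfConcordant.abs_inner_le hK hx (gradient f x) u
  rw [inner_gradient_left] at h
  exact h.trans (mul_le_mul_of_nonneg_right (Real.sqrt_le_sqrt (hb.grad_le x hx))
    (formNorm_nonneg u))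

lemma fderiv_sq_le (hb : IsBarrier K f M ν) (hK : IsCompact K) {x : Vec d}
    (hx : x ∈ interior K) (u : Vec d) :
    fderiv ℝ f x u ^ 2 ≤ ν * hessForm f x u u := by
  rw [← (hb.selfConcordant.isPsd hx).sq_formNorm u, ← Real.sq_sqrt hb.nonneg, ← mul_pow]
  exact sq_le_sq' (neg_le_of_abs_le (hb.abs_fderiv_le hK hx u))
    (le_of_abs_le (hb.abs_fderiv_le hK hx u))

/-- The parameters of a barrier on a bounded domain satisfy `M √ν ≥ 1`. -/
lemma one_le_mul_sqrt (hb : IsBarrier K f M ν) (hd : 0 < d) (hK : IsCompact K)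
    (hne : (interior K).Nonempty) : 1 ≤ M * Real.sqrt ν := by
  by_contra! hlt
  have hsc := hb.selfConcordant
  have hM := hsc.nonneg
  obtain ⟨x, hx⟩ := hne
  set u : Vec d := EuclideanSpace.single ⟨0, hd⟩ 1 with hu'
  have hu : u ≠ 0 := by
    rw [hu', Ne, ← norm_eq_zero, PiLp.norm_single]; simp
  obtain ⟨τ, hτ, hin, hout⟩ := exists_exit hK hx hu
  -- The summand 1 keeps κ positive when ν = 0, which is not yet excluded.
  set κ := Real.sqrt ν + 1 with hκ
  set a := 1 - M * Real.sqrt ν with ha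
  have hκ0 : 0 < κ := by positivity
  have ha0 : 0 < a := by linarith
  set p : ℝ → ℝ := fun s => fderiv ℝ f (x + s • u) u with hp
  set n : ℝ → ℝ := fun s => formNorm (hessForm f (x + s • u)) u with hn
  have hnpos : ∀ s ∈ Ico 0 τ, 0 < n s := fun s hs => hsc.formNorm_pos hK (hin s hs) hu
  have hpn : ∀ s ∈ Ico 0 τ, |p s| ≤ Real.sqrt ν * n s := fun s hs =>
    hb.abs_fderiv_le hK (hin s hs) u
  have hq : ∀ s ∈ Ico 0 τ, |p s / n s| ≤ κ := fun s hs => by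
    rw [abs_div, abs_of_pos (hnpos s hs), div_le_iff₀ (hnpos s hs)]
    refine (hpn s hs).trans (mul_le_mul_of_nonneg_right ?_ (hnpos s hs).le)
    linarith
  have h0 : (0 : ℝ) ∈ Ico 0 τ := ⟨le_rfl, hτ⟩
  obtain ⟨t, ht, -, hlt'⟩ :=
    exists_large_of_exit hsc.blowup hτ hin hout (f x + 2 * κ * (κ / a)) 0 hτ
  have hsub : ∀ s ∈ Icc 0 t, s ∈ Ico 0 τ := fun s hs => ⟨hs.1, hs.2.trans_lt ht.2⟩
  -- If a = 1 - M√ν > 0, then (p/n)' ≥ a·n ≥ (a/κ)p. As p/n stays in [-κ, κ], the function f gains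
  -- at most 2κ²/a along the ray, contradicting blow-up.
  have key := le_of_hasDerivAt_nonneg (φ := fun s => p s / n s - a / κ * f (x + s • u)) ht.1
    (fun s hs => (((hsc.deriv_fderiv_line (hin s (hsub s hs)) u).div
      ((hsc.deriv_hessForm_line (hin s (hsub s hs)) u u).sqrt
        (hsc.hessForm_pos hK (hin s (hsub s hs)) hu).ne')
        (hnpos s (hsub s hs)).ne').sub
      ((hsc.deriv_line (hin s (hsub s hs))).const_mul (a / κ))))
    (fun s hs => by
      have hs' := hsub s hs
      have e1 := hsc.thirdForm_diag_le (hin s hs') u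
      have e2 := (hsc.isPsd (hin s hs')).sq_formNorm u
      have e3 := hpn s hs'
      have e4 := hnpos s hs'
      simp only [hp, hn] at e3 e4
      rw [show Real.sqrt (hessForm f (x + s • u) u u) = formNorm (hessForm f (x + s • u)) u from rfl,
        ← e2]
      set N := formNorm (hessForm f (x + s • u)) u
      set P := fderiv ℝ f (x + s • u) u
      set D := thirdForm f (x + s • u) u u u
      have e5 : (N ^ 2 * N - P * (D / (2 * N))) / N ^ 2 = N - P * D / (2 * N ^ 3) := by
        field_simp
      have e6 : P * D / (2 * N ^ 3) ≤ M * Real.sqrt ν * N := by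
        rw [div_le_iff₀ (by positivity)]
        calc P * D ≤ |P| * |D| := (le_abs_self _).trans (abs_mul P D).le
          _ ≤ (Real.sqrt ν * N) * (2 * M * N ^ 3) := by gcongr
          _ = _ := by ring
      have e7 : a / κ * P ≤ a * N := by
        rw [div_mul_eq_mul_div, div_le_iff₀ hκ0, mul_assoc]
        refine mul_le_mul_of_nonneg_left ?_ ha0.le
        have := le_abs_self P
        rw [hκ]; linarith
      rw [e5]
      have e8 : a * N = N - M * Real.sqrt ν * N := by rw [ha]; ring
      linarith)
  have k1 := abs_le.1 (hq t ht)
  have k2 := abs_le.1 (hq 0 h0)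
  simp only [zero_smul, add_zero] at key
  have k3 : a / κ * (f (x + t • u) - f x) ≤ 2 * κ := by linarith [k1.2, k2.1]
  have k4 : a / κ * (2 * κ * (κ / a)) < a / κ * (f (x + t • u) - f x) :=
    mul_lt_mul_of_pos_left (by linarith) (by positivity)
  have k5 : a / κ * (2 * κ * (κ / a)) = 2 * κ := by field_simp
  linarith

lemma pos (hb : IsBarrier K f M ν) (hd : 0 < d) (hK : IsCompact K)
    (hne : (interior K).Nonempty) : 0 < ν := by
  have := hb.one_le_mul_sqrt hd hK hne
  refine lt_of_le_of_ne hb.nonneg fun h => ?_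
  rw [← h, Real.sqrt_zero] at this
  norm_num at this

/-- For p the derivative along the ray, p² ≤ νp', so 1/p falls at rate at least 1/ν once p > 0. Then
p would be infinite by time t + ν/p(t), which cannot precede time 1. -/
lemma fderiv_mul_le (hb : IsBarrier K f M ν) (hK : IsCompact K) (hν : 0 < ν) {x u : Vec d}
    (hin : ∀ t ∈ Ico (0 : ℝ) 1, x + t • u ∈ interior K) {t : ℝ} (ht : t ∈ Ico (0 : ℝ) 1) :
    fderiv ℝ f (x + t • u) u * (1 - t) ≤ ν := by
  have hsc := hb.selfConcordant
  set p : ℝ → ℝ := fun s => fderiv ℝ f (x + s • u) u with hp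
  rcases le_or_gt (p t) 0 with h0 | h0
  · exact (mul_nonpos_of_nonpos_of_nonneg h0 (by linarith [ht.2])).trans hν.le
  have hmono : ∀ s ∈ Ico t 1, p t ≤ p s := by
    intro s hs
    have hsub : ∀ r ∈ Icc t s, r ∈ Ico (0 : ℝ) 1 := fun r hr =>
      ⟨ht.1.trans hr.1, hr.2.trans_lt hs.2⟩
    exact le_of_hasDerivAt_nonneg hs.1
      (fun r hr => hsc.deriv_fderiv_line (hin r (hsub r hr)) u)
      (fun r hr => hsc.hessForm_nonneg (hin r (hsub r hr)) u)
  have hlt : ∀ s ∈ Ico t 1, s ≤ t + ν / p t := by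
    intro s hs
    have hsub : ∀ r ∈ Icc t s, r ∈ Ico (0 : ℝ) 1 := fun r hr =>
      ⟨ht.1.trans hr.1, hr.2.trans_lt hs.2⟩
    have hpos : ∀ r ∈ Icc t s, 0 < p r := fun r hr =>
      h0.trans_le (hmono r ⟨hr.1, hr.2.trans_lt hs.2⟩)
    have := le_of_hasDerivAt_nonneg (φ := fun r => -(p r)⁻¹ - ν⁻¹ * r) hs.1
      (fun r hr => ((hsc.deriv_fderiv_line (hin r (hsub r hr)) u).inv (hpos r hr).ne').neg.sub
        ((hasDerivAt_id r).const_mul ν⁻¹))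
      (fun r hr => by
        have h1 := hb.fderiv_sq_le hK (hin r (hsub r hr)) u
        have h2 := hpos r hr
        simp only [hp] at h2
        have h3 : ν⁻¹ ≤ hessForm f (x + r • u) u u / fderiv ℝ f (x + r • u) u ^ 2 := by
          rw [le_div_iff₀ (by positivity), inv_mul_le_iff₀ hν]
          exact h1
        rw [neg_div, neg_neg]
        linarith)
    have h4 := inv_pos.2 (hpos s (right_mem_Icc.2 hs.1))
    have h5 : ν⁻¹ * s - ν⁻¹ * t ≤ (p t)⁻¹ := by linarith
    rw [← mul_sub, inv_mul_le_iff₀ hν] at h5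
    rw [div_eq_mul_inv]
    linarith
  have h1 : 1 ≤ t + ν / p t := by
    refine le_of_forall_lt_imp_le_of_dense fun s hs => ?_
    rcases le_or_gt t s with h | h
    · exact hlt s ⟨h, hs⟩
    · have := div_pos hν h0
      linarith
  have h2 : 1 - t ≤ ν / p t := by linarith
  rw [le_div_iff₀ h0] at h2
  rw [mul_comm]
  exact h2

/-- A barrier grows at most logarithmically. -/
lemma growth (hb : IsBarrier K f M ν) (hK : IsCompact K) (hν : 0 < ν) {x u : Vec d}
    (hin : ∀ t ∈ Ico (0 : ℝ) 1, x + t • u ∈ interior K) {t : ℝ} (ht : t ∈ Ico (0 : ℝ) 1) :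
    f (x + t • u) - f x ≤ -(ν * Real.log (1 - t)) := by
  have hsub : ∀ r ∈ Icc 0 t, r ∈ Ico (0 : ℝ) 1 := fun r hr => ⟨hr.1, hr.2.trans_lt ht.2⟩
  have := le_of_hasDerivAt_nonneg
    (φ := fun r => -(ν * Real.log (1 - r)) - f (x + r • u)) ht.1
    (fun r hr => ((((hasDerivAt_id r).const_sub 1).log
      (by have := (hsub r hr).2; simp only [id]; linarith)).const_mul ν).neg.sub
      (hb.selfConcordant.deriv_line (hin r (hsub r hr))))
    (fun r hr => by
      have h1 := hb.fderiv_mul_le hK hν hin (hsub r hr)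
      have h2 : 0 < 1 - r := by have := (hsub r hr).2; linarith
      rw [← le_div_iff₀ h2] at h1
      simp only [id]
      have : -(ν * (-1 / (1 - r))) = ν / (1 - r) := by ring
      linarith)
  simp only [zero_smul, add_zero, sub_zero, Real.log_one, mul_zero, neg_zero] at this
  linarith

end IsBarrier

namespace IsSelfConcordant

/-- The linear term is bounded on K, so blow-up keeps sublevel sets away from the boundary and makes
them compact. -/
lemma exists_min (hsc : IsSelfConcordant K f M) (hK : IsCompact K) (hne : (interior K).Nonempty)
    (s : Vec d) :
    ∃ z ∈ interior K, ∀ y ∈ interior K, f z + inner ℝ s z ≤ f y + inner ℝ s y := by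
  obtain ⟨x, hx⟩ := hne
  have hin : Continuous fun y : Vec d => inner ℝ s y := by fun_prop
  have hfc : ContinuousOn f (interior K) := hsc.smooth.continuousOn
  have hF : ContinuousOn (fun y => f y + inner ℝ s y) (interior K) := hfc.add hin.continuousOn
  obtain ⟨B, hB⟩ := hK.exists_bound_of_continuousOn hin.continuousOn
  set S := {y | y ∈ interior K ∧ f y + inner ℝ s y ≤ f x + inner ℝ s x} with hS
  have hSK : S ⊆ interior K := fun y hy => hy.1
  have hclosed : IsClosed S := by
    refine isClosed_of_closure_subset fun y hy => ?_
    have hyK : y ∈ K := hK.isClosed.closure_subset_iff.2 (hSK.trans interior_subset) hy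
    have hne : (𝓝[S] y).NeBot := mem_closure_iff_nhdsWithin_neBot.1 hy
    have hle : 𝓝[S] y ≤ 𝓝[interior K] y := nhdsWithin_mono y hSK
    by_cases hyi : y ∈ interior K
    · refine ⟨hyi, ?_⟩
      refine le_of_tendsto ((hF y hyi).tendsto.mono_left hle) ?_
      filter_upwards [self_mem_nhdsWithin] with z hz using hz.2
    · exfalso
      have hfr : y ∈ frontier K := ⟨subset_closure hyK, hyi⟩
      have h1 := ((hsc.blowup y hfr).mono_left hle).eventually_gt_atTop
        (f x + inner ℝ s x + B)
      obtain ⟨z, hz1, hz2⟩ := (h1.and self_mem_nhdsWithin).exists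
      have h2 := hB z (interior_subset hz2.1)
      have h3 := hz2.2
      have h4 := (abs_le.1 h2).1
      linarith
  have hcomp : IsCompact S := hK.of_isClosed_subset hclosed (hSK.trans interior_subset)
  obtain ⟨z, hz, hmin⟩ := hcomp.exists_isMinOn ⟨x, hx, le_rfl⟩ (hF.mono hSK)
  refine ⟨z, hz.1, fun y hy => ?_⟩
  by_cases hyS : y ∈ S
  · exact hmin hyS
  · have : f x + inner ℝ s x < f y + inner ℝ s y := by
      by_contra! hc
      exact hyS ⟨hy, hc⟩
    exact hz.2.trans this.le

lemma fderiv_eq_of_min (hsc : IsSelfConcordant K f M) {s z : Vec d} (hz : z ∈ interior K)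
    (hmin : ∀ y ∈ interior K, f z + inner ℝ s z ≤ f y + inner ℝ s y) (u : Vec d) :
    fderiv ℝ f z u = -inner ℝ s u := by
  have hloc : IsLocalMin (fun y => f y + inner ℝ s y) z := by
    filter_upwards [isOpen_interior.mem_nhds hz] with y hy using hmin y hy
  have h1 : HasFDerivAt f (fderiv ℝ f z) z :=
    ((hsc.smooth.contDiffAt (isOpen_interior.mem_nhds hz)).differentiableAt
      (by norm_num)).hasFDerivAt
  have h2 : HasFDerivAt (fun y : Vec d => inner ℝ s y) (innerSL ℝ s) z :=
    (innerSL ℝ s).hasFDerivAt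
  have h3 := hloc.hasFDerivAt_eq_zero (h1.add h2)
  have h4 := congrArg (fun L : Vec d →L[ℝ] ℝ => L u) h3
  simp only [add_apply, innerSL_apply_apply, zero_apply] at h4
  linarith

end IsSelfConcordant

end Barons

/-! ### Geometry around a landmark: strong monotonicity and the Newton step. -/

namespace Barons

variable {d : ℕ} {K : Set (Vec d)} {f : Vec d → ℝ} {M : ℝ}

/-- `B` is a spectral approximation of the Hessian of `f` at the landmark `u`. -/
structure IsLandmark (K : Set (Vec d)) (f : Vec d → ℝ) (u : Vec d)
    (B : LinearMap.BilinForm ℝ (Vec d)) : Prop where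
  mem : u ∈ interior K
  symm : ∀ v w, B v w = B w v
  lower : ∀ v, 999 / 1000 * hessForm f u v v ≤ B v v
  upper : ∀ v, B v v ≤ 1001 / 1000 * hessForm f u v v

namespace IsLandmark

variable {u : Vec d} {B : LinearMap.BilinForm ℝ (Vec d)} (hB : IsLandmark K f u B)
  (hsc : IsSelfConcordant K f M)
include hB hsc

lemma isPsd : IsPsd B :=
  ⟨hB.symm, fun v => by
    have := hB.lower v
    have := hsc.hessForm_nonneg hB.mem v
    linarith⟩

variable (hK : IsCompact K) (hKc : Convex ℝ K)
include hK hKc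

/-- At radius 1/(30M) the stability factor is at least 0.8999²; combined with the oracle's 1 ± 0.001
it leaves room for 2/3 and 5/4. In particular the Hessian differs from B by at most B/3, the source
of the Newton contraction rate. -/
lemma near {x : Vec d} (hx : 30 * M * formNorm B (x - u) ≤ 1) :
    x ∈ interior K ∧ ∀ v, 2 / 3 * B v v ≤ hessForm f x v v ∧ hessForm f x v v ≤ 5 / 4 * B v v := by
  have hP := hB.isPsd hsc
  have hM := hsc.nonneg
  have hr : formNorm (hessForm f u) (x - u) ≤ 1001 / 1000 * formNorm B (x - u) := by
    refine formNorm_le_mul (by norm_num) ?_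
    have := hB.lower (x - u)
    have := hP.nonneg (x - u)
    linarith
  have hxu : u + (x - u) = x := by abel
  set r := 1001 / 1000 * formNorm B (x - u) with hr'
  have hMr : 0 ≤ M * r := mul_nonneg hM ((formNorm_nonneg _).trans hr)
  have hMr1 : 3 * M * r ≤ 1001 / 10000 := by rw [hr']; linarith
  refine ⟨?_, fun v => ?_⟩
  · have := hsc.dikin hK hB.mem (h := x - u) (by
      have := mul_le_mul_of_nonneg_left hr hM
      linarith)
    rwa [hxu] at this
  · obtain ⟨h1, h2⟩ := hsc.hessForm_stable hK hKc hB.mem hr (by linarith) v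
    rw [hxu] at h1 h2
    have hu0 := hsc.hessForm_nonneg hB.mem v
    have hl := hB.lower v
    have hh := hB.upper v
    have hB0 := hP.nonneg v
    have hsq : (8999 / 10000 : ℝ) ^ 2 ≤ (1 - 3 * M * r) ^ 2 :=
      pow_le_pow_left₀ (by norm_num) (by linarith) 2
    have h3 := mul_le_mul_of_nonneg_left hsq hu0
    constructor
    · linarith
    · by_contra! hc
      have hx0 : 0 ≤ hessForm f x v v := by linarith
      have h4 := mul_le_mul_of_nonneg_left hsq hx0
      linarith

lemma formNorm_le_near {x : Vec d} (hx : 30 * M * formNorm B (x - u) ≤ 1) (v : Vec d) :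
    formNorm (hessForm f x) v ≤ 7 / 6 * formNorm B v := by
  refine formNorm_le_mul (by norm_num) ?_
  have := ((hB.near hsc hK hKc hx).2 v).2
  have := (hB.isPsd hsc).nonneg v
  linarith

omit hK hKc in
lemma near_mono {x y : Vec d} {ρ : ℝ} (h : 30 * M * (formNorm B (x - u) + ρ) ≤ 1)
    (hy : formNorm B (y - x) ≤ ρ) : 30 * M * formNorm B (y - u) ≤ 1 := by
  refine le_trans (mul_le_mul_of_nonneg_left ?_ (by have := hsc.nonneg; positivity)) h
  have := (hB.isPsd hsc).formNorm_sub_le y x u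
  linarith

/-- Strong monotonicity of the gradient around the landmark. -/
lemma dist_le_of_fderiv_sub_le {x₀ x₁ : Vec d} {ρ β : ℝ}
    (h₀ : 30 * M * (formNorm B (x₀ - u) + ρ) ≤ 1) (hβ : 0 ≤ β) (hβρ : 3 / 2 * β < ρ)
    (h₁ : x₁ ∈ interior K)
    (hg : fderiv ℝ f x₁ (x₁ - x₀) - fderiv ℝ f x₀ (x₁ - x₀) ≤ β * formNorm B (x₁ - x₀)) :
    formNorm B (x₁ - x₀) ≤ 3 / 2 * β := by
  by_contra! hlt
  have hP := hB.isPsd hsc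
  set h := x₁ - x₀ with hh
  set n := formNorm B h with hn
  have hn0 : 0 < n := by linarith
  have hρ : 0 < ρ := by linarith
  have hx₀ : x₀ ∈ interior K :=
    (hB.near hsc hK hKc (hB.near_mono hsc h₀ (by rw [sub_self, formNorm_zero]; exact hρ.le))).1
  -- Nothing places x₁ near the landmark. Strong convexity is used only on the part of the segment
  -- within ρ of x₀, and plain monotonicity beyond; that part alone already yields the
  -- contradiction.
  set t := min 1 (ρ / n) with ht
  have ht0 : 0 < t := lt_min one_pos (by positivity)
  have ht1 : t ≤ 1 := min_le_left _ _
  have htn : t * n ≤ ρ := by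
    have := min_le_right 1 (ρ / n)
    rwa [← ht, le_div_iff₀ hn0] at this
  have htβ : 3 / 2 * β < t * n := by
    rcases min_choice 1 (ρ / n) with hc | hc
    · rw [ht, hc, one_mul]; exact hlt
    · rw [ht, hc, div_mul_cancel₀ _ hn0.ne']; exact hβρ
  have hin : ∀ s ∈ Icc (0 : ℝ) 1, x₀ + s • h ∈ interior K := fun s hs =>
    segment_mem_interior hKc hx₀ (by rw [hh]; simpa using h₁) hs
  have g1 := le_of_hasDerivAt_nonneg (φ := fun s => fderiv ℝ f (x₀ + s • h) h - 2 / 3 * n ^ 2 * s)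
    ht0.le
    (fun s hs => (hsc.deriv_fderiv_line (hin s ⟨hs.1, hs.2.trans ht1⟩) h).sub
      ((hasDerivAt_id s).const_mul _))
    (fun s hs => by
      have hd : formNorm B (x₀ + s • h - x₀) ≤ ρ := by
        rw [add_sub_cancel_left, formNorm_smul, abs_of_nonneg hs.1, ← hn]
        exact (mul_le_mul_of_nonneg_right hs.2 hn0.le).trans htn
      have := ((hB.near hsc hK hKc (hB.near_mono hsc h₀ hd)).2 h).1
      rw [← hP.sq_formNorm, ← hn] at this
      linarith)
  have g2 := le_of_hasDerivAt_nonneg (φ := fun s => fderiv ℝ f (x₀ + s • h) h) ht1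
    (fun s hs => hsc.deriv_fderiv_line (hin s ⟨ht0.le.trans hs.1, hs.2⟩) h)
    (fun s hs => hsc.hessForm_nonneg (hin s ⟨ht0.le.trans hs.1, hs.2⟩) h)
  have e1 : x₀ + h = x₁ := by rw [hh]; abel
  simp only [zero_smul, add_zero, mul_zero, sub_zero, one_smul, e1] at g1 g2
  have g3 : 2 / 3 * n * (t * n) ≤ β * n := by linarith
  have g4 : 2 / 3 * n * (3 / 2 * β) < 2 / 3 * n * (t * n) :=
    mul_lt_mul_of_pos_left htβ (by positivity)
  linarith

/-- One approximate Newton step contracts the distance to the minimizer. -/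
lemma newton_step {w z p s e : Vec d} {ε : ℝ} (hε : 0 ≤ ε)
    (hw : 30 * M * formNorm B (w - u) ≤ 1) (hz : 30 * M * formNorm B (z - u) ≤ 1)
    (hs : ∀ v, fderiv ℝ f z v = -inner ℝ s v)
    (he : ∀ v, |inner ℝ (e - gradient f w) v| ≤ ε * formNorm (hessForm f w) v)
    (hp : ∀ v, B v p = inner ℝ v (e + s)) :
    formNorm B (w - p - z) ≤ 1 / 3 * formNorm B (w - z) + 7 / 6 * ε := by
  have hP := hB.isPsd hsc
  have hM := hsc.nonneg
  set h := w - z with hh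
  set v := w - p - z with hv
  have hseg : ∀ t ∈ Icc (0 : ℝ) 1, 30 * M * formNorm B (z + t • h - u) ≤ 1 := by
    intro t ht
    have e1 : z + t • h - u = t • (w - u) + (1 - t) • (z - u) := by rw [hh]; module
    have e2 := hP.formNorm_add_le (t • (w - u)) ((1 - t) • (z - u))
    rw [formNorm_smul, formNorm_smul, abs_of_nonneg ht.1, abs_of_nonneg (by linarith [ht.2])] at e2
    rw [e1]
    have h1 := mul_le_mul_of_nonneg_left hw ht.1
    have h2 := mul_le_mul_of_nonneg_left hz (by linarith [ht.2] : 0 ≤ 1 - t)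
    have h3 := mul_le_mul_of_nonneg_left e2 (by positivity : 0 ≤ 30 * M)
    linarith
  have hd : ∀ t ∈ Icc (0 : ℝ) 1, HasDerivAt (fun t : ℝ => fderiv ℝ f (z + t • h) v)
      (hessForm f (z + t • h) h v) t := fun t ht =>
    hsc.deriv_fderiv_line (hB.near hsc hK hKc (hseg t ht)).1 v
  -- The gradient is tested against the new error v, so the scalar mean value theorem suffices. With
  -- ∇f(z) = -s, it turns ‖v‖² into (B - ∇²f(z + ξh))(h, v) minus the oracle error tested on v.
  obtain ⟨ξ, hξ, hmv⟩ := exists_hasDerivAt_eq_slope _ _ (zero_lt_one (α := ℝ))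
    (fun t ht => (hd t ht).continuousAt.continuousWithinAt)
    (fun t ht => hd t (Ioo_subset_Icc_self ht))
  have e1 : z + h = w := by rw [hh]; abel
  simp only [one_smul, zero_smul, add_zero, sub_zero, div_one, e1] at hmv
  have hξ' := Ioo_subset_Icc_self hξ
  obtain ⟨hξK, hξb⟩ := hB.near hsc hK hKc (hseg ξ hξ')
  have hdiff := hP.abs_apply_le_of_diag (D := B - hessForm f (z + ξ • h)) (δ := 1 / 3)
    (fun a b => by
      simp only [LinearMap.sub_apply]
      rw [hP.symm a b, hsc.hessForm_symm hξK a b])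
    (fun a => by
      have := hξb a
      have := hP.nonneg a
      simp only [LinearMap.sub_apply]
      rw [abs_le]; constructor <;> linarith) h v
  simp only [LinearMap.sub_apply] at hdiff
  have he' := (he v).trans (mul_le_mul_of_nonneg_left (hB.formNorm_le_near hsc hK hKc hw v) hε)
  rw [inner_sub_left, inner_gradient_left] at he'
  have hpv : B p v = inner ℝ e v + inner ℝ s v := by
    rw [hP.symm, hp, inner_add_right, real_inner_comm, real_inner_comm s]
  have hvv : formNorm B v ^ 2 = B h v - B p v := by
    rw [hP.sq_formNorm, ← LinearMap.sub_apply, ← map_sub]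
    congr 2
    rw [hv, hh]; abel
  have hzs := hs v
  have key : formNorm B v * formNorm B v ≤ (1 / 3 * formNorm B h + 7 / 6 * ε) * formNorm B v := by
    have k1 := (abs_le.1 hdiff).2
    have k2 := (abs_le.1 he').1
    nlinarith
  rcases (formNorm_nonneg (B := B) v).eq_or_lt with h0 | h0
  · rw [← h0]
    have := formNorm_nonneg (B := B) h
    positivity
  · exact le_of_mul_le_mul_right key h0

end IsLandmark

end Barons

/-! ### Operation counts and the Newton iteration. -/

namespace Barons

namespace Timed

variable {α β : Type} {d : ℕ}

@[simp] lemma bind_val (x : Timed α) (k : α → Timed β) : (x >>= k).val = (k x.val).val := rfl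
@[simp] lemma bind_cost (x : Timed α) (k : α → Timed β) :
    (x >>= k).cost = x.cost + (k x.val).cost := rfl
@[simp] lemma pure_val (a : α) : (pure a : Timed α).val = a := rfl
@[simp] lemma pure_cost (a : α) : (pure a : Timed α).cost = 0 := rfl
@[simp] lemma op_val (a : α) : (op a).val = a := rfl
@[simp] lemma op_cost (a : α) : (op a).cost = 1 := rfl

@[simp] lemma copy_val (x : Vec d) : (copy x).val = x := rfl
@[simp] lemma copy_cost (x : Vec d) : (copy x).cost = d := by simp [copy, vec]
@[simp] lemma add_val (x y : Vec d) : (add x y).val = x + y := rfl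
@[simp] lemma add_cost (x y : Vec d) : (add x y).cost = d := by simp [add, vec]
@[simp] lemma sub_val (x y : Vec d) : (sub x y).val = x - y := rfl
@[simp] lemma sub_cost (x y : Vec d) : (sub x y).cost = d := by simp [sub, vec]
@[simp] lemma smul_val (r : ℝ) (x : Vec d) : (smul r x).val = r • x := rfl
@[simp] lemma smul_cost (r : ℝ) (x : Vec d) : (smul r x).cost = d := by simp [smul, vec]
@[simp] lemma matVec_val (A : Mat d) (x : Vec d) :
    (matVec A x).val = WithLp.toLp 2 (A.mulVec x.ofLp) := rfl
@[simp] lemma matVec_cost (A : Mat d) (x : Vec d) : (matVec A x).cost = 2 * d ^ 2 := by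
  simp [matVec, vec, sum]; ring
@[simp] lemma dot_val (x y : Vec d) : (dot x y).val = x.ofLp ⬝ᵥ y.ofLp := rfl
@[simp] lemma dot_cost (x y : Vec d) : (dot x y).cost = 2 * d := by simp [dot, sum]; ring
@[simp] lemma norm_val (A : Mat d) (x : Vec d) : (norm A x).val = formNorm (matForm A) x := by
  simp [norm, formNorm, matForm_apply]
@[simp] lemma norm_cost (A : Mat d) (x : Vec d) : (norm A x).cost = 2 * d ^ 2 + 2 * d + 1 := by
  simp [norm]; ring
lemma le_val (x y : ℝ) : (le x y).val = true ↔ x ≤ y := by simp [le]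
@[simp] lemma le_cost (x y : ℝ) : (le x y).cost = 1 := rfl

end Timed

variable {d : ℕ} {K : Set (Vec d)} {f : Vec d → ℝ} {M ε : ℝ}

lemma IsHessOracle.isLandmark {C : ℕ} {O : Vec d → Timed (Mat d × Mat d)}
    (hO : IsHessOracle K f (1 / 1000) C O) (hsc : IsSelfConcordant K f M) {w : Vec d}
    (hw : w ∈ interior K) : IsLandmark K f w (matForm (O w).val.1) := by
  obtain ⟨-, h1, h2, -, -, -⟩ := hO w hw
  refine ⟨hw, matForm_symm ?_, fun v => ?_, fun v => ?_⟩
  -- Symmetry of the returned matrix is recovered by adding a multiple of the Hessian to the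
  -- symmetric difference in the Loewner bound.
  · have e1 := h1.sub_isSymm
    have e2 := (hessian_isSymm isOpen_interior hsc.smooth hw).smul (1 - 1 / 1000 : ℝ)
    have := e1.add e2
    rwa [sub_add_cancel] at this
  · have := h1.form_le v
    rw [matForm_smul, matForm_hessian] at this
    simp only [LinearMap.smul_apply, smul_eq_mul] at this
    linarith
  · have := h2.form_le v
    rw [matForm_smul, matForm_hessian] at this
    simp only [LinearMap.smul_apply, smul_eq_mul] at this
    linarith

section Newton

variable {P : Input d} {u z s : Vec d} {H R : Mat d} {Cg : ℕ}

/-- The error recursion x ↦ x/3 + 7/6·ε has fixed point 7/4·ε, so the excess D above it is divided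
by 3 in each step. The radius condition keeps all iterates where the step analysis applies. -/
lemma newtonSteps_spec (hsc : IsSelfConcordant K f M) (hK : IsCompact K) (hKc : Convex ℝ K)
    (hB : IsLandmark K f u (matForm H)) (hHR : H * R = 1) (hε : 0 ≤ ε)
    (hO : IsGradOracle K f ε Cg P.gradOracle)
    (hs : ∀ v, fderiv ℝ f z v = -inner ℝ s v) (k : ℕ) :
    ∀ (w : Vec d) (D : ℝ), 0 ≤ D →
      30 * M * (formNorm (matForm H) (z - u) + (D + 7 / 4 * ε)) ≤ 1 →
      formNorm (matForm H) (w - z) ≤ D + 7 / 4 * ε →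
      formNorm (matForm H) ((newtonSteps P R s k w).val - z) ≤ (1 / 3) ^ k * D + 7 / 4 * ε ∧
      (newtonSteps P R s k w).cost ≤ k * (1 + Cg + 2 * d + 2 * d ^ 2) := by
  induction k with
  | zero => intro w D _ _ hw; simpa [newtonSteps] using hw
  | succ k ih =>
    intro w D hD hR hw
    have hw1 : 30 * M * formNorm (matForm H) (w - u) ≤ 1 := hB.near_mono hsc hR hw
    have hz1 : 30 * M * formNorm (matForm H) (z - u) ≤ 1 :=
      hB.near_mono hsc hR (by rw [sub_self, formNorm_zero]; positivity)
    have hwK := (hB.near hsc hK hKc hw1).1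
    obtain ⟨hg, hc⟩ := hO w hwK
    set ghat := (P.gradOracle w).val
    set p : Vec d := WithLp.toLp 2 (R.mulVec (ghat + s).ofLp) with hp
    have hstep := hB.newton_step hsc hK hKc (p := p) hε hw1 hz1 hs
      (fun v => (hsc.abs_inner_le hK hwK _ v).trans
        (mul_le_mul_of_nonneg_right hg (formNorm_nonneg v)))
      (fun v => matForm_mulVec hHR v (ghat + s))
    have hM := hsc.nonneg
    obtain ⟨i1, i2⟩ := ih (w - p) (D / 3) (by positivity)
      (le_trans (mul_le_mul_of_nonneg_left (by linarith) (by positivity)) hR) (by linarith)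
    have e : newtonSteps P R s (k + 1) w = (do
      Timed.op ()
      let ghat ← P.gradOracle w
      let gtilde ← Timed.add ghat s
      let p ← Timed.matVec R gtilde
      let w' ← Timed.sub w p
      newtonSteps P R s k w') := rfl
    rw [e]
    constructor
    · simp only [Timed.bind_val, Timed.add_val, Timed.matVec_val, Timed.sub_val]
      refine i1.trans (le_of_eq ?_)
      ring
    · simp only [Timed.bind_cost, Timed.add_val, Timed.matVec_val, Timed.sub_val,
        Timed.op_cost, Timed.add_cost, Timed.matVec_cost, Timed.sub_cost]
      have : (k + 1) * (1 + Cg + 2 * d + 2 * d ^ 2) =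
        k * (1 + Cg + 2 * d + 2 * d ^ 2) + (1 + Cg + 2 * d + 2 * d ^ 2) := by ring
      rw [this]
      linarith

end Newton

/-- The invariant of the algorithm: the landmark is close to the iterate, and the iterate is close
to the minimizer `z` of `f + ⟨s, ·⟩`. -/
structure Invariant (K : Set (Vec d)) (f : Vec d → ℝ) (M ε : ℝ) (S : State d) (z : Vec d) :
    Prop where
  landmark : IsLandmark K f S.u (matForm S.H)
  inverse : S.H * S.Hinv = 1
  close : 41 * M * formNorm (matForm S.H) (S.w - S.u) ≤ 1
  near : formNorm (matForm S.H) (S.w - z) ≤ 3 * ε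
  mem : z ∈ interior K
  stationary : ∀ v, fderiv ℝ f z v = -inner ℝ S.s v

namespace Invariant

variable {S : State d} {z : Vec d} (hI : Invariant K f M ε S z) (hsc : IsSelfConcordant K f M)
  (hK : IsCompact K) (hKc : Convex ℝ K)
include hI hsc

lemma iterate_close : 30 * M * formNorm (matForm S.H) (S.w - S.u) ≤ 1 := by
  have h1 := hI.close
  have h2 : 0 ≤ M * formNorm (matForm S.H) (S.w - S.u) :=
    mul_nonneg hsc.nonneg (formNorm_nonneg _)
  linarith

include hK hKc

lemma iterate_mem : S.w ∈ interior K :=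
  (hI.landmark.near hsc hK hKc (hI.iterate_close hsc)).1

lemma abs_inner_le {b : ℝ} {g : Vec d} (hb : 0 ≤ b)
    (hg : ∀ v, |inner ℝ g v| ≤ b * formNorm (hessForm f S.w) v) (v : Vec d) :
    |inner ℝ g v| ≤ 7 / 6 * b * formNorm (matForm S.H) v := by
  have := mul_le_mul_of_nonneg_left
    (hI.landmark.formNorm_le_near hsc hK hKc (hI.iterate_close hsc) v) hb
  linarith [hg v]

variable (hM0 : 0 < M) {η b : ℝ} {g z' : Vec d} (hη : 0 ≤ η) (hb : 0 ≤ b)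
  (hMε : 20000 * M * ε ≤ 1) (hMη : 1000 * M * (η * b) ≤ 1)
  (hg : ∀ v, |inner ℝ g v| ≤ b * formNorm (hessForm f S.w) v)
include hM0 hη hb hMε hMη hg

/-- The gradients at the two minimizers differ by -ηg, of dual norm at most 7/6·ηb; strong
monotonicity multiplies this by 3/2. The trust radius ρ = 2/(1000M) exceeds the resulting 7/4·ηb and
still fits in the ball around the landmark. -/
lemma minimizer_move (hz' : z' ∈ interior K)
    (hst : ∀ v, fderiv ℝ f z' v = -inner ℝ (S.s + η • g) v) :
    formNorm (matForm S.H) (z' - z) ≤ 7 / 4 * (η * b) := by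
  have hP := hI.landmark.isPsd hsc
  have hηb : 0 ≤ η * b := mul_nonneg hη hb
  have hzu : 41 * M * formNorm (matForm S.H) (z - S.u) ≤ 1 + 41 * M * (3 * ε) := by
    have h1 := hP.formNorm_sub_le z S.w S.u
    have h2 := hI.near
    rw [formNorm_sub_comm] at h2
    have h3 := mul_le_mul_of_nonneg_left (h1.trans (add_le_add_left h2 _))
      (by positivity : 0 ≤ 41 * M)
    linarith [hI.close]
  have hgrad : fderiv ℝ f z' (z' - z) - fderiv ℝ f z (z' - z) ≤
      7 / 6 * (η * b) * formNorm (matForm S.H) (z' - z) := by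
    rw [hst, hI.stationary, inner_add_left, inner_smul_left]
    have := mul_le_mul_of_nonneg_left
      (neg_le_of_abs_le (hI.abs_inner_le hsc hK hKc hb hg (z' - z))) hη
    simp only [conj_trivial]
    linarith
  have hρ1 : 3 / 2 * (7 / 6 * (η * b)) < 2 / (1000 * M) := by
    rw [lt_div_iff₀ (by positivity)]
    linarith
  have hρ2 : 1000 * M * (2 / (1000 * M)) = 2 := by field_simp
  have := hI.landmark.dist_le_of_fderiv_sub_le hsc hK hKc (β := 7 / 6 * (η * b))
    (ρ := 2 / (1000 * M))
    (by
      have := formNorm_nonneg (B := matForm S.H) (z - S.u)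
      linarith) (by positivity) hρ1 hz' hgrad
  linarith

end Invariant

end Barons

/-! ### One round, and the whole run. -/

namespace Barons

variable {d : ℕ} {K : Set (Vec d)} {f : Vec d → ℝ} {M ε : ℝ}

section RoundUnfold

variable (P : Input d) (g : Vec d) (S : State d)

lemma round_of_close
    (h : formNorm (matForm S.H)
      ((newtonSteps P S.Hinv (S.s + P.η • g) (P.mNewton - 1) S.w).val - S.u) ≤ 1 / (41 * P.M)) :
    (round P g S).val =
      { w := (newtonSteps P S.Hinv (S.s + P.η • g) (P.mNewton - 1) S.w).val
        u := S.u, H := S.H, Hinv := S.Hinv, s := S.s + P.η • g } ∧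
    (round P g S).cost =
      (newtonSteps P S.Hinv (S.s + P.η • g) (P.mNewton - 1) S.w).cost + (2 * d ^ 2 + 7 * d + 4) := by
  have h' := (Timed.le_val _ _).2 h
  constructor
  · simp [round, h', -one_div]
  · simp [round, h', -one_div]; ring

lemma round_of_far
    (h : ¬ formNorm (matForm S.H)
      ((newtonSteps P S.Hinv (S.s + P.η • g) (P.mNewton - 1) S.w).val - S.u) ≤ 1 / (41 * P.M)) :
    (round P g S).val =
      { w := (newtonSteps P S.Hinv (S.s + P.η • g) (P.mNewton - 1) S.w).val
        u := (newtonSteps P S.Hinv (S.s + P.η • g) (P.mNewton - 1) S.w).val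
        H := (P.hessOracle (newtonSteps P S.Hinv (S.s + P.η • g) (P.mNewton - 1) S.w).val).val.1
        Hinv := (P.hessOracle (newtonSteps P S.Hinv (S.s + P.η • g) (P.mNewton - 1) S.w).val).val.2
        s := S.s + P.η • g } ∧
    (round P g S).cost =
      (newtonSteps P S.Hinv (S.s + P.η • g) (P.mNewton - 1) S.w).cost + (2 * d ^ 2 + 7 * d + 4) +
      (P.hessOracle (newtonSteps P S.Hinv (S.s + P.η • g) (P.mNewton - 1) S.w).val).cost := by
  have h' : ¬ (Timed.le (formNorm (matForm S.H)
      ((newtonSteps P S.Hinv (S.s + P.η • g) (P.mNewton - 1) S.w).val - S.u))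
      (1 / (41 * P.M))).val = true := fun hc => h ((Timed.le_val _ _).1 hc)
  constructor
  · simp [round, h', -one_div]
  · simp [round, h', -one_div]; ring

end RoundUnfold

/-- One round preserves the invariant, with `j` calls of the Hessian oracle, paid for by the
movement of the iterate. -/
lemma Invariant.round_spec {P : Input d} {S : State d} {z z' g : Vec d} {b : ℝ} {Cg Ch : ℕ}
    (hI : Invariant K f P.M ε S z) (hsc : IsSelfConcordant K f P.M) (hK : IsCompact K)
    (hKc : Convex ℝ K) (hM0 : 0 < P.M) (hε : 0 ≤ ε) (hη : 0 ≤ P.η) (hb : 0 ≤ b)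
    (hMε : 20000 * P.M * ε ≤ 1) (hMη : 1000 * P.M * (P.η * b) ≤ 1)
    (hg : ∀ v, |inner ℝ g v| ≤ b * formNorm (hessForm f S.w) v)
    (hm : (1 / 3 : ℝ) ^ (P.mNewton - 1) ≤ 3 * (ε * P.M))
    (hOg : IsGradOracle K f ε Cg P.gradOracle) (hOh : IsHessOracle K f (1 / 1000) Ch P.hessOracle)
    (hz' : z' ∈ interior K) (hst : ∀ v, fderiv ℝ f z' v = -inner ℝ (S.s + P.η • g) v) :
    Invariant K f P.M ε (round P g S).val z' ∧ ∃ j : ℕ,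
      (round P g S).cost ≤ P.mNewton * (1 + Cg + 2 * d + 2 * d ^ 2) + (2 * d ^ 2 + 7 * d + 4) +
        j * Ch ∧
      j + 41 * P.M * formNorm (matForm (round P g S).val.H)
          ((round P g S).val.w - (round P g S).val.u) ≤
        41 * P.M * formNorm (matForm S.H) (S.w - S.u) + 41 * P.M * (5 * ε + 2 * (P.η * b)) := by
  have hB := hI.landmark
  have hP := hB.isPsd hsc
  have hηb : 0 ≤ P.η * b := mul_nonneg hη hb
  have hmove := hI.minimizer_move hsc hK hKc hM0 hη hb hMε hMη hg hz' hst
  have hnear := hI.near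
  set n := formNorm (matForm S.H) with hn
  have hwz' : n (S.w - z') ≤ 3 * ε + 7 / 4 * (P.η * b) := by
    have h1 := hP.formNorm_sub_le S.w z z'
    have h2 : n (z - z') = n (z' - z) := formNorm_sub_comm _ _
    rw [← hn, h2] at h1
    linarith
  -- Chosen so that D + 7/4·ε is the bound just found on the distance from the old iterate to the
  -- new minimizer.
  set D := 5 / 4 * ε + 7 / 4 * (P.η * b) with hD
  have hD0 : 0 ≤ D := by positivity
  have hR : 30 * P.M * (n (z' - S.u) + (D + 7 / 4 * ε)) ≤ 1 := by
    have h1 := hP.formNorm_sub_le z' S.w S.u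
    have h2 : n (z' - S.w) = n (S.w - z') := formNorm_sub_comm _ _
    rw [← hn, h2] at h1
    have h3 : n (z' - S.u) + (D + 7 / 4 * ε) ≤ n (S.w - S.u) + (6 * ε + 7 / 2 * (P.η * b)) := by
      linarith
    have h4 := mul_le_mul_of_nonneg_left h3 (by positivity : 0 ≤ 30 * P.M)
    have h5 := hI.close
    rw [← hn] at h5
    have h6 : 0 ≤ P.M * ε := by positivity
    have h7 : 0 ≤ P.M * (P.η * b) := by positivity
    linarith
  obtain ⟨hN, hcost⟩ := newtonSteps_spec (P := P) hsc hK hKc hB hI.inverse hε hOg hst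
    (P.mNewton - 1) S.w D hD0 hR (by rw [← hn]; linarith)
  have hcost' := hcost.trans
    (Nat.mul_le_mul_right (1 + Cg + 2 * d + 2 * d ^ 2) (Nat.sub_le P.mNewton 1))
  set W := newtonSteps P S.Hinv (S.s + P.η • g) (P.mNewton - 1) S.w with hW
  -- MD ≤ 1/100, so the contracted excess is at most 3ε/100, well below ε/4.
  have hWz : n (W.val - z') ≤ 2 * ε := by
    have h1 := mul_le_mul_of_nonneg_right hm hD0
    have h2 : P.M * D ≤ 1 / 100 := by rw [hD]; linarith
    have h3 := mul_le_mul_of_nonneg_left h2 (by positivity : 0 ≤ 3 * ε)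
    rw [← hn] at hN
    linarith
  have hWu : 30 * P.M * n (W.val - S.u) ≤ 1 := hB.near_mono hsc hR (by rw [← hn]; linarith)
  have hmv : n (W.val - S.u) ≤ n (S.w - S.u) + (5 * ε + 2 * (P.η * b)) := by
    have h1 := hP.formNorm_sub_le W.val z' S.u
    have h2 := hP.formNorm_sub_le z' S.w S.u
    have h3 : n (z' - S.w) = n (S.w - z') := formNorm_sub_comm _ _
    rw [← hn] at h1 h2
    linarith
  have hmv' := mul_le_mul_of_nonneg_left hmv (by positivity : 0 ≤ 41 * P.M)
  obtain ⟨hWK, hWb⟩ := hB.near hsc hK hKc hWu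
  by_cases hc : n (W.val - S.u) ≤ 1 / (41 * P.M)
  · obtain ⟨e1, e2⟩ := round_of_close P g S hc
    rw [e1, e2]
    refine ⟨⟨hB, hI.inverse, ?_, ?_, hz', hst⟩, 0, ?_, ?_⟩
    · rw [le_div_iff₀ (by positivity)] at hc
      rw [mul_comm]
      exact hc
    · exact hWz.trans (by linarith)
    · rw [zero_mul, add_zero, ← hW]
      exact Nat.add_le_add_right hcost' _
    · rw [Nat.cast_zero, zero_add, ← hW]
      linarith
  · obtain ⟨e1, e2⟩ := round_of_far P g S hc
    rw [e1, e2]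
    have hB' := hOh.isLandmark hsc hWK
    refine ⟨⟨hB', (hOh _ hWK).1, ?_, ?_, hz', hst⟩, 1, ?_, ?_⟩
    · rw [sub_self, formNorm_zero]; norm_num
    -- Passing to the new landmark's norm costs a factor 7/6, and 7/6·2ε ≤ 3ε; this is why the
    -- invariant allows 3ε.
    · refine (formNorm_le_mul (B := matForm S.H) (κ := 7 / 6) (by norm_num) ?_).trans
        (by rw [← hn]; linarith : 7 / 6 * formNorm (matForm S.H) (W.val - z') ≤ 3 * ε)
      have h1 := hB'.upper (W.val - z')
      have h2 := (hWb (W.val - z')).2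
      have h3 := hP.nonneg (W.val - z')
      linarith
    · rw [one_mul, ← hW]
      exact Nat.add_le_add (Nat.add_le_add_right hcost' _) (hOh _ hWK).2.2.2.2.2
    · rw [sub_self, formNorm_zero, mul_zero, add_zero, Nat.cast_one]
      -- The potential has just passed 1 and is reset to 0, which pays for the oracle call.
      rw [not_le, div_lt_iff₀ (by positivity)] at hc
      linarith

/-- The state after `t` rounds satisfies the invariant. -/
lemma run_spec {P : Input d} {z g : ℕ → Vec d} {b : ℝ} {T Cg Ch : ℕ}
    (hsc : IsSelfConcordant K f P.M) (hK : IsCompact K)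
    (hKc : Convex ℝ K) (hM0 : 0 < P.M) (hε : 0 ≤ ε) (hη : 0 ≤ P.η) (hb : 0 ≤ b)
    (hMε : 20000 * P.M * ε ≤ 1) (hMη : 1000 * P.M * (P.η * b) ≤ 1)
    (hm : (1 / 3 : ℝ) ^ (P.mNewton - 1) ≤ 3 * (ε * P.M))
    (hOg : IsGradOracle K f ε Cg P.gradOracle) (hOh : IsHessOracle K f (1 / 1000) Ch P.hessOracle)
    (hg : ∀ t < T, localNorm (hessian f (iterate P g t))⁻¹ (g t) ≤ b)
    (hz0 : z 0 = P.wstar) (hz : ∀ t, z t ∈ interior K)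
    (hst : ∀ t v, fderiv ℝ f (z t) v = -inner ℝ (∑ i ∈ Finset.range t, P.η • g i) v) :
    ∀ t ≤ T, Invariant K f P.M ε (run P g t).val (z t) ∧
      (run P g t).val.s = ∑ i ∈ Finset.range t, P.η • g i ∧ ∃ N : ℕ,
      (run P g t).cost ≤ t * (P.mNewton * (1 + Cg + 2 * d + 2 * d ^ 2) + (2 * d ^ 2 + 7 * d + 4)) +
        (N + 1) * Ch + d ∧
      N + 41 * P.M * formNorm (matForm (run P g t).val.H)
          ((run P g t).val.w - (run P g t).val.u) ≤
        t * (41 * P.M * (5 * ε + 2 * (P.η * b))) := by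
  intro t
  induction t with
  | zero =>
    intro _
    have hw : P.wstar ∈ interior K := hz0 ▸ hz 0
    have e1 : (run P g 0).val =
        { w := P.wstar, u := P.wstar, H := (P.hessOracle P.wstar).val.1
          Hinv := (P.hessOracle P.wstar).val.2, s := 0 } := rfl
    have e2 : (run P g 0).cost = (P.hessOracle P.wstar).cost + d := by
      simp [run, init, Timed.vec]
    rw [e1, e2]
    -- N leaves out the initial Hessian call, which is the extra 1 in N + 1; the d operations write
    -- the zero vector.
    refine ⟨⟨hOh.isLandmark hsc hw, (hOh _ hw).1, ?_, ?_, hz 0, ?_⟩, by simp, 0, ?_, ?_⟩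
    · simp [formNorm_zero]
    · rw [hz0, sub_self, formNorm_zero]; positivity
    · intro v; simpa using hst 0 v
    · have := (hOh _ hw).2.2.2.2.2
      simpa using this
    · simp [formNorm_zero]
  | succ t ih =>
    intro ht
    obtain ⟨hI, hs, N, hN1, hN2⟩ := ih (Nat.le_of_succ_le ht)
    have hwK := hI.iterate_mem hsc hK hKc
    have e1 : (run P g (t + 1)).val = (round P (g t) (run P g t).val).val := rfl
    have e2 : (run P g (t + 1)).cost =
        (run P g t).cost + (round P (g t) (run P g t).val).cost := rfl
    have hsum : (run P g t).val.s + P.η • g t = ∑ i ∈ Finset.range (t + 1), P.η • g i := by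
      rw [hs, Finset.sum_range_succ]
    obtain ⟨hI', j, hj1, hj2⟩ := hI.round_spec hsc hK hKc hM0 hε hη hb hMε hMη
      (fun v => (hsc.abs_inner_le hK hwK _ v).trans
        (mul_le_mul_of_nonneg_right (hg t ht) (formNorm_nonneg v)))
      hm hOg hOh (hz (t + 1)) (fun v => by rw [hsum]; exact hst (t + 1) v)
    rw [e1, e2]
    refine ⟨hI', ?_, N + j, ?_, ?_⟩
    · rw [← hsum]
      by_cases hc : formNorm (matForm (run P g t).val.H)
        ((newtonSteps P (run P g t).val.Hinv ((run P g t).val.s + P.η • g t) (P.mNewton - 1)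
          (run P g t).val.w).val - (run P g t).val.u) ≤ 1 / (41 * P.M)
      · rw [(round_of_close P (g t) _ hc).1]
      · rw [(round_of_far P (g t) _ hc).1]
    · have : ∀ X : ℕ, (t + 1) * X + (N + j + 1) * Ch + d =
        (t * X + (N + 1) * Ch + d) + (X + j * Ch) := fun X => by ring
      rw [this]
      exact Nat.add_le_add hN1 hj1
    · push_cast
      linarith

end Barons

/-! ### Regret of the approximate leader. -/

namespace Barons

variable {d : ℕ} {K : Set (Vec d)} {f : Vec d → ℝ} {M ν : ℝ}

/-- By induction: the leader at time t does no worse on its own objective than the next leader. -/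
lemma be_the_leader {z g : ℕ → Vec d} {η : ℝ} (hz : ∀ t, z t ∈ interior K)
    (hmin : ∀ t, ∀ y ∈ interior K, f (z t) + inner ℝ (∑ i ∈ Finset.range t, η • g i) (z t) ≤
      f y + inner ℝ (∑ i ∈ Finset.range t, η • g i) y) (t : ℕ) :
    f (z 0) + ∑ i ∈ Finset.range t, η * inner ℝ (g i) (z (i + 1)) ≤
      f (z t) + inner ℝ (∑ i ∈ Finset.range t, η • g i) (z t) := by
  induction t with
  | zero => simp
  | succ t ih =>
    have h1 := hmin t _ (hz (t + 1))
    rw [Finset.sum_range_succ, Finset.sum_range_succ, inner_add_left, real_inner_smul_left]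
    linarith

/-- A comparator lies at time 1 - c on a segment from w⋆ to a point of K, so the growth bound gives
-ν log c. -/
lemma shrunken_growth (hb : IsBarrier K f M ν) (hK : IsCompact K) (hKc : Convex ℝ K) (hν : 0 < ν)
    {wstar w : Vec d} (hw : wstar ∈ interior K) {c : ℝ} (hc0 : 0 < c) (hc1 : c < 1)
    (h : w ∈ shrunken K wstar c) :
    w ∈ interior K ∧ f w - f wstar ≤ ν * Real.log (1 / c) := by
  obtain ⟨_, ⟨y, hy, rfl⟩, _, rfl, rfl⟩ := h
  have hin : ∀ t ∈ Ico (0 : ℝ) 1, wstar + t • (y - wstar) ∈ interior K := by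
    intro t ht
    have := hKc.combo_interior_self_mem_interior hw hy (sub_pos.2 ht.2) ht.1 (by ring)
    convert this using 1
    module
  have ht : 1 - c ∈ Ico (0 : ℝ) 1 := ⟨by linarith, by linarith⟩
  change (1 - c) • y + c • wstar ∈ interior K ∧ f ((1 - c) • y + c • wstar) - f wstar ≤ _
  have e : (1 - c) • y + c • wstar = wstar + (1 - c) • (y - wstar) := by
    module
  rw [e]
  refine ⟨hin _ ht, ?_⟩
  have := hb.growth hK hν hin ht
  rwa [sub_sub_cancel, ← mul_neg, ← Real.log_inv, ← one_div] at this

/-- The leader at time 0 is set to the algorithm's starting point by hand, which avoids an argument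
for uniqueness of minimizers. -/
lemma exists_leaders (hsc : IsSelfConcordant K f M) (hK : IsCompact K) {wstar : Vec d}
    (hw : IsBarrierMin K f wstar) (s : ℕ → Vec d) (hs : s 0 = 0) :
    ∃ z : ℕ → Vec d, z 0 = wstar ∧ (∀ t, z t ∈ interior K) ∧
      ∀ t, ∀ y ∈ interior K, f (z t) + inner ℝ (s t) (z t) ≤ f y + inner ℝ (s t) y := by
  choose z hz hmin using fun t => hsc.exists_min hK ⟨wstar, hw.1⟩ (s t)
  refine ⟨fun t => if t = 0 then wstar else z t, by simp, fun t => ?_, fun t y hy => ?_⟩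
  · by_cases h : t = 0
    · simpa [h] using hw.1
    · simpa [h] using hz t
  · by_cases h : t = 0
    · simpa [h, hs] using hw.2 hy
    · simpa [h] using hmin t y hy

lemma regret_le {P : Input d} {z g : ℕ → Vec d} {l : ℕ → Vec d → ℝ} {b ε G : ℝ} {T : ℕ} {w : Vec d}
    (hsc : IsSelfConcordant K f P.M) (hK : IsCompact K) (hKc : Convex ℝ K) (hM0 : 0 < P.M)
    (hη : 0 < P.η) (hb : 0 ≤ b)
    (hMε : 20000 * P.M * ε ≤ 1) (hMη : 1000 * P.M * (P.η * b) ≤ 1)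
    (hI : ∀ t ≤ T, Invariant K f P.M ε (run P g t).val (z t))
    (hs : ∀ t ≤ T, (run P g t).val.s = ∑ i ∈ Finset.range t, P.η • g i)
    (hg : ∀ t < T, localNorm (hessian f (iterate P g t))⁻¹ (g t) ≤ b)
    (hl : ∀ t < T, IsSubgradient (interior K) (l t) (iterate P g t) (g t))
    (hmin : ∀ t, ∀ y ∈ interior K,
      f (z t) + inner ℝ (∑ i ∈ Finset.range t, P.η • g i) (z t) ≤
      f y + inner ℝ (∑ i ∈ Finset.range t, P.η • g i) y)
    (hz : ∀ t, z t ∈ interior K) (hw : w ∈ interior K) (hG : f w - f (z 0) ≤ P.η * G) :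
    regret P g l T w ≤ T * (b * (7 / 2 * ε + 3 * (P.η * b))) + G := by
  have hstat : ∀ t v, fderiv ℝ f (z t) v = -inner ℝ (∑ i ∈ Finset.range t, P.η • g i) v :=
    fun t => hsc.fderiv_eq_of_min (hz t) (hmin t)
  -- Split at z_t and z_{t+1}: tracking costs 7/6·3 = 7/2 times bε, and the move of the minimizer
  -- 7/6·7/4 ≤ 3 times ηb².
  have hround : ∀ t ∈ Finset.range T, l t (iterate P g t) - l t w ≤
      b * (7 / 2 * ε + 3 * (P.η * b)) + inner ℝ (g t) (z (t + 1) - w) := by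
    intro t ht
    rw [Finset.mem_range] at ht
    have hIt := hI t ht.le
    have hwK := hIt.iterate_mem hsc hK hKc
    have hg' : ∀ v, |inner ℝ (g t) v| ≤ b * formNorm (hessForm f (run P g t).val.w) v := fun v =>
      (hsc.abs_inner_le hK hwK _ v).trans
        (mul_le_mul_of_nonneg_right (hg t ht) (formNorm_nonneg v))
    have h1 := hl t ht w hw
    have h2 := (abs_le.1 (hIt.abs_inner_le hsc hK hKc hb hg' (iterate P g t - z t))).2
    have h3 := (abs_le.1 (hIt.abs_inner_le hsc hK hKc hb hg' (z (t + 1) - z t))).1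
    have h4 := hIt.minimizer_move hsc hK hKc hM0 hη.le hb hMε hMη hg' (hz (t + 1)) (fun v => by
      rw [hs t ht.le, ← Finset.sum_range_succ]
      exact hstat (t + 1) v)
    have h5 := hIt.near
    have h6 := mul_le_mul_of_nonneg_left h4 (by positivity : 0 ≤ 7 / 6 * b)
    have h7 := mul_le_mul_of_nonneg_left h5 (by positivity : 0 ≤ 7 / 6 * b)
    have h8 : 0 ≤ b * (P.η * b) := by positivity
    simp only [inner_sub_right] at h1 h2 h3 ⊢
    simp only [iterate] at *
    linarith
  have hsum := Finset.sum_le_sum hround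
  rw [Finset.sum_add_distrib, Finset.sum_const, Finset.card_range, nsmul_eq_mul] at hsum
  have hbtl := be_the_leader hz hmin T
  have hT := hmin T w hw
  have hsw : inner ℝ (∑ i ∈ Finset.range T, P.η • g i) w =
      P.η * ∑ i ∈ Finset.range T, inner ℝ (g i) w := by
    rw [sum_inner, Finset.mul_sum]
    simp only [real_inner_smul_left]
  rw [hsw] at hT
  rw [← Finset.mul_sum] at hbtl
  have hlead : ∑ t ∈ Finset.range T, inner ℝ (g t) (z (t + 1) - w) ≤ G := by
    refine le_of_mul_le_mul_left ?_ hη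
    simp only [inner_sub_right, Finset.sum_sub_distrib]
    linarith
  rw [regret, ← Finset.sum_sub_distrib]
  linarith

/-- Since e ≤ 3, the power with exponent m is at most r; the missing step costs the factor 3. For m
= 0 the truncated exponent is 0, and 1 ≤ 3 still holds. -/
lemma third_pow_le {m : ℕ} {r : ℝ} (hr : 0 < r) (hm : Real.log (1 / r) ≤ m) :
    (1 / 3 : ℝ) ^ (m - 1) ≤ 3 * r := by
  have h1 : Real.exp (-m) ≤ r := by
    rw [one_div, Real.log_inv] at hm
    rw [← Real.le_log_iff_exp_le hr]
    linarith
  have h2 : (1 / 3 : ℝ) ≤ Real.exp (-1) := by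
    rw [Real.exp_neg, one_div]
    exact inv_anti₀ (Real.exp_pos 1) (by linarith [Real.exp_one_lt_d9])
  have h3 : (1 / 3 : ℝ) ^ m ≤ Real.exp (-m) := by
    have : Real.exp (-(m : ℝ)) = Real.exp (-1) ^ m := by
      rw [← Real.exp_nat_mul]; ring_nf
    rw [this]
    exact pow_le_pow_left₀ (by norm_num) h2 m
  have h4 : (1 / 3 : ℝ) ^ (m - 1) ≤ 3 * (1 / 3) ^ m := by
    rcases m with _ | m
    · norm_num
    · rw [Nat.add_sub_cancel, pow_succ]; linarith
  linarith

end Barons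

/-! ### Choice of constants and conclusion. -/

theorem theorem2 :
    -- `a` and `A` are the implicit constants in `mNewton = Θ(log (1 / (ε M)))`
    ∃ a : ℝ, 0 < a ∧ ∃ C : ℝ, 0 < C ∧ ∀ A : ℝ, ∃ C' : ℝ, 0 < C' ∧
    ∀ (d : ℕ) (_ : 0 < d) (K : Set (Barons.Vec d))
      (_ : Convex ℝ K) (_ : IsCompact K) (_ : (interior K).Nonempty)
      (Φ : Barons.Vec d → ℝ) (M ν : ℝ) (_ : 0 < M) (_ : Barons.IsBarrier K Φ M ν)
      (c b : ℝ) (_ : 0 < c) (_ : c < 1) (_ : 0 < b)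
      (T : ℕ) (_ : 1 ≤ T) (η ε : ℝ)
      (_ : η = Real.sqrt (ν * Real.log (1 / c) / (b ^ 2 * T)))
      (_ : ε = Real.sqrt (ν / T))
      (_ : η ≤ 1 / (1000 * b * M)) (_ : ε ≤ 1 / (20000 * M))
      (mNewton : ℕ)
      (_ : a * Real.log (1 / (ε * M)) ≤ mNewton) (_ : mNewton ≤ A * Real.log (1 / (ε * M)))
      (Cgrad Chess : ℕ)
      (gradOracle : Barons.Vec d → Barons.Timed (Barons.Vec d))
      (_ : Barons.IsGradOracle K Φ ε Cgrad gradOracle)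
      (hessOracle : Barons.Vec d → Barons.Timed (Barons.Mat d × Barons.Mat d))
      (_ : Barons.IsHessOracle K Φ (1 / 1000) Chess hessOracle)
      (wstar : Barons.Vec d) (_ : Barons.IsBarrierMin K Φ wstar)
      (P : Barons.Input d)
      (_ : P = ⟨η, M, mNewton, gradOracle, hessOracle, wstar⟩)
      (l : ℕ → Barons.Vec d → ℝ) (g : ℕ → Barons.Vec d)
      (_ : ∀ t < T, Barons.IsSubgradient (interior K) (l t) (Barons.iterate P g t) (g t))
      (_ : ∀ t < T,
        Barons.localNorm (Barons.hessian Φ (Barons.iterate P g t))⁻¹ (g t) ≤ b),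
      (∀ t < T, Barons.iterate P g t ∈ interior K) ∧
      (∀ w ∈ Barons.shrunken K wstar c,
        Barons.regret P g l T w ≤ C * (b * Real.sqrt (ν * T * (1 + Real.log (1 / c))))) ∧
      (Barons.totalCost P g T : ℝ) ≤
        C' * ((Cgrad + (d : ℝ) ^ 2) * T * Real.log (T / (ν * M ^ 2)) +
          Chess * (M * Real.sqrt (T * ν * (1 + Real.log (1 / c))))) := by
  -- 8 dominates 7/2 + 3 + 1 in the regret. In the cost, 288 = 41·(5 + 2) + 1 counts Hessian calls
  -- and also covers the overhead 13 + 1 of the rounds; 5|A| covers the Newton steps.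
  refine ⟨1, one_pos, 8, by norm_num, fun A => ⟨288 + 5 * |A|, by positivity, ?_⟩⟩
  intro d hd K hKc hK hne Φ M ν hM hbar c b hc0 hc1 hb T hT η ε hη hε hηle hεle m hm1 hm2
    Cg Ch gO hgO hO hhO wstar hws P hP l g hl hg
  have hsc := hbar.selfConcordant
  have hν : 0 < ν := hbar.pos hd hK hne
  have hMν := hbar.one_le_mul_sqrt hd hK hne
  set L := Real.log (1 / c) with hL
  have hL0 : 0 < L := Real.log_pos (by rw [lt_div_iff₀ hc0]; linarith)
  have hT1 : (1 : ℝ) ≤ T := by exact_mod_cast hT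
  have hT0 : (0 : ℝ) < T := by linarith
  have hη0 : 0 < η := by rw [hη]; positivity
  have hε0 : 0 < ε := by rw [hε]; positivity
  have hMε : 20000 * M * ε ≤ 1 := by
    rw [le_div_iff₀ (by positivity)] at hεle; linarith
  have hMη : 1000 * M * (η * b) ≤ 1 := by
    rw [le_div_iff₀ (by positivity)] at hηle; linarith
  have hε2 : ε ^ 2 = ν / T := by rw [hε, Real.sq_sqrt (by positivity)]
  have hη2 : (η * b) ^ 2 * T = ν * L := by
    rw [mul_pow, hη, Real.sq_sqrt (by positivity)]; field_simp
  set S := Real.sqrt (ν * T * (1 + L)) with hS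
  have hεT : T * ε ≤ S := by
    refine Real.le_sqrt_of_sq_le ?_
    rw [mul_pow, hε2]
    have : (T : ℝ) ^ 2 * (ν / T) = ν * T := by field_simp
    rw [this]
    have : 0 ≤ ν * T * L := by positivity
    linarith
  have hηT : T * (η * b) ≤ S := by
    refine Real.le_sqrt_of_sq_le ?_
    have : (T * (η * b)) ^ 2 = ν * T * L := by
      rw [mul_pow]; linear_combination (T : ℝ) * hη2
    rw [this]
    have : 0 ≤ ν * T := by positivity
    linarith
  have hS1 : 1 ≤ M * S := by
    refine hMν.trans (mul_le_mul_of_nonneg_left (Real.sqrt_le_sqrt ?_) hM.le)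
    have h1 : ν * 1 ≤ ν * T := mul_le_mul_of_nonneg_left hT1 hν.le
    have h2 : 0 ≤ ν * T * L := by positivity
    linarith
  have hεM : 0 < ε * M := by positivity
  have hm : (1 / 3 : ℝ) ^ (m - 1) ≤ 3 * (ε * M) := Barons.third_pow_le hεM (by linarith)
  obtain ⟨z, hz0, hz, hmin⟩ := Barons.exists_leaders hsc hK hws
    (fun t => ∑ i ∈ Finset.range t, η • g i) (by simp)
  have hst := fun t => hsc.fderiv_eq_of_min (hz t) (hmin t)
  have hrun := Barons.run_spec (P := P) (z := z) (g := g) (b := b) (T := T) (Cg := Cg) (Ch := Ch)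
    (ε := ε) (K := K) (f := Φ)
  subst hP
  replace hrun := hrun hsc hK hKc hM hε0.le hη0.le hb.le hMε hMη hm hgO hhO hg hz0 hz hst
  refine ⟨fun t ht => (hrun t ht.le).1.iterate_mem hsc hK hKc, fun w hw => ?_, ?_⟩
  · obtain ⟨hwK, hgr⟩ := Barons.shrunken_growth hbar hK hKc hν hws.1 hc0 hc1 hw
    -- G is νL/η rewritten through η²b²T = νL.
    have hreg := Barons.regret_le (P := ⟨η, M, m, gO, hO, wstar⟩) (G := b * (T * (η * b))) hsc hK
      hKc hM hη0 hb.le hMε hMη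
      (fun t ht => (hrun t ht).1) (fun t ht => (hrun t ht).2.1) hg hl hmin hz hwK (by
        rw [hz0]
        refine hgr.trans (le_of_eq ?_)
        show ν * L = η * (b * (T * (η * b)))
        linear_combination -hη2)
    refine hreg.trans ?_
    show T * (b * (7 / 2 * ε + 3 * (η * b))) + b * (T * (η * b)) ≤ 8 * (b * S)
    have h1 := mul_le_mul_of_nonneg_left hεT hb.le
    have h2 := mul_le_mul_of_nonneg_left hηT hb.le
    have h3 : 0 ≤ b * S := by positivity
    linarith
  · obtain ⟨-, -, N, hN1, hN2⟩ := hrun T le_rfl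
    have hNS : (N : ℝ) ≤ 287 * (M * S) := by
      have h1 : 0 ≤ 41 * M * Barons.formNorm (Barons.matForm
        (Barons.run ⟨η, M, m, gO, hO, wstar⟩ g T).val.H)
        ((Barons.run ⟨η, M, m, gO, hO, wstar⟩ g T).val.w -
          (Barons.run ⟨η, M, m, gO, hO, wstar⟩ g T).val.u) :=
        mul_nonneg (by positivity) (Barons.formNorm_nonneg _)
      have h2 := mul_le_mul_of_nonneg_left hεT hM.le
      have h3 := mul_le_mul_of_nonneg_left hηT hM.le
      simp only at hN2
      linarith
    set Λ := Real.log (T / (ν * M ^ 2)) with hΛ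
    -- By the choice of ε, T/(νM²) is the square of 1/(εM). As εM ≤ 1/20000, the logarithm exceeds 1
    -- and absorbs lower-order costs.
    have hΛ2 : Λ = 2 * Real.log (1 / (ε * M)) := by
      have : T / (ν * M ^ 2) = (1 / (ε * M)) ^ 2 := by
        rw [div_pow, mul_pow, hε2]; field_simp
      rw [hΛ, this, Real.log_pow]; norm_num
    have hlog : 1 ≤ Real.log (1 / (ε * M)) := by
      rw [Real.le_log_iff_exp_le (by positivity), le_div_iff₀ hεM]
      have := Real.exp_one_lt_d9
      nlinarith
    have hmA : (m : ℝ) ≤ |A| * Λ := by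
      have h1 := mul_le_mul_of_nonneg_right (le_abs_self A) (by linarith : 0 ≤ Real.log (1 / (ε * M)))
      have h2 : 0 ≤ |A| * Real.log (1 / (ε * M)) := by positivity
      rw [hΛ2]; linarith
    have hd1 : (1 : ℝ) ≤ d := by exact_mod_cast hd
    have hdd : (d : ℝ) ≤ d ^ 2 := by nlinarith
    have hcast : (Barons.totalCost ⟨η, M, m, gO, hO, wstar⟩ g T : ℝ) ≤
        T * (m * (1 + Cg + 2 * d + 2 * d ^ 2) + (2 * d ^ 2 + 7 * d + 4)) + (N + 1) * Ch + d := by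
      have : ((Barons.run ⟨η, M, m, gO, hO, wstar⟩ g T).cost : ℝ) ≤ _ := Nat.cast_le.2 hN1
      push_cast at this
      exact this
    have hTν : T * ν * (1 + L) = ν * T * (1 + L) := by ring
    rw [hTν, ← hS]
    set Q := (Cg : ℝ) + d ^ 2 with hQ
    have hCg : (0 : ℝ) ≤ Cg := Nat.cast_nonneg _
    have hCh : (0 : ℝ) ≤ Ch := Nat.cast_nonneg _
    have hQ0 : 0 ≤ Q := by positivity
    have hΛ1 : 1 ≤ Λ := by linarith
    have b1 : m * (1 + Cg + 2 * d + 2 * (d : ℝ) ^ 2) ≤ |A| * Λ * (5 * Q) :=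
      mul_le_mul hmA (by linarith) (by positivity) (by positivity)
    have b2 : 2 * (d : ℝ) ^ 2 + 7 * d + 4 ≤ 13 * (Q * Λ) := by
      have : Q * 1 ≤ Q * Λ := mul_le_mul_of_nonneg_left hΛ1 hQ0
      linarith
    have b3 : (d : ℝ) ≤ T * (Q * Λ) := by
      have h1 : Q * 1 ≤ Q * Λ := mul_le_mul_of_nonneg_left hΛ1 hQ0
      have h2 : 1 * (Q * Λ) ≤ T * (Q * Λ) := mul_le_mul_of_nonneg_right hT1 (by positivity)
      linarith
    have b4 : (N + 1) * (Ch : ℝ) ≤ 288 * (M * S) * Ch :=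
      mul_le_mul_of_nonneg_right (by linarith) hCh
    have b5 := mul_le_mul_of_nonneg_left (add_le_add b1 b2) hT0.le
    have b6 : 0 ≤ T * (Q * Λ) := by positivity
    have b7 : 0 ≤ |A| * (Ch * (M * S)) := by positivity
    linarith
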